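/- **Setting.** Fix $L\ge 1$, a reward noise level $\sigma>0$ and $\sigma_1,\dots,\sigma_{L+1}>0$. Let $K\ge1$ be the number of actions, $d$ the dimension, and $W_1,\dots,W_L\in\mathbb R^{d\times d}$ known matrices with $\lambda_1(W_\ell^\top W_\ell)=1$ for all $\ell\in[L]$ ($\lambda_1$ = largest eigenvalue). Action parameters $\theta=(\theta_a)_{a\in[K]}\in(\mathbb R^d)^K$ are drawn from the hierarchical prior $$\psi_L\sim\mathcal N(0,\sigma_{L+1}^2I_d),\qquad \psi_{\ell-1}\mid\psi_\ell\sim\mathcal N(W_\ell\psi_\ell,\sigma_\ell^2I_d)\ (2\le\ell\le L),\qquad \theta_a\mid\psi_1\sim\mathcal N(W_1\psi_1,\sigma_1^2I_d),$$ the $\theta_a$ being independent given $\psi_1$. In round $t=1,\dots,n$ a context $X_t\in\mathbb R^d$ with $\|X_t\|_2=1$ is revealed, drawn from an arbitrary distribution that may depend on the history $H_t=(X_i,A_i,Y_i)_{i<t}$ (and, given $H_t$, on nothing else); the agent takes an action $A_t\in[K]$ and observes $Y_t\sim\mathcal N(X_t^\top\theta_{A_t},\sigma^2)$. *Diffusion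 Thompson sampling (dTS)* samples, in round $t$, $\psi_{t,L}$ from the posterior $p(\psi_L\mid H_t)$, then $\psi_{t,\ell-1}$ from $p(\psi_{\ell-1}\mid\psi_\ell=\psi_{t,\ell},H_t)$ for $\ell=L,\dots,2$, then independently over $a$ $\theta_{t,a}$ from $p(\theta_a\mid\psi_1=\psi_{t,1},H_t)$, and plays $A_t\in\arg\max_{a\in[K]}X_t^\top\theta_{t,a}$ (ties broken by the least index). Its Bayes regret is $$\mathcal{BR}(n)=\mathbb E\Big[\sum_{t=1}^n\big(\max_{a\in[K]}X_t^\top\theta_a-X_t^\top\theta_{A_t}\big)\Big],$$ the expectation being over the prior, the contexts, the rewards and the algorithm's sampling. Put $\sigma_{\max}^2=\max_{\ell\in[L+1]}\big(1+\sigma_\ell^2/\sigma^2\big)$. **Theorem.** (1) There is a constant $c>0$, depending only on $K,L,\sigma,\sigma_1,\dots,\sigma_{L+1}$ (so not on $n$, $\delta$, $d$, the $W_\ell$ or the contexts), such that for all $n$ the random variable in the definition of $\mathcal{BR}(n)$ is integrable and, for every $\delta\in(0,1)$, $$\mathcal{BR}(n)\le\sqrt{2n\Big(\mathcal R^{\mathrm{act}}(n)+\sum_{\ell=1}^L\mathcal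 R^{\mathrm{lat}}_\ell\Big)\log(1/\delta)}+c\,n\,\delta,$$ where $$\mathcal R^{\mathrm{act}}(n)=c_0\,dK\log\Big(1+\frac{n\sigma_1^2}{d}\Big),\quad c_0=\frac{\sigma_1^2}{\log(1+\sigma_1^2)},\qquad \mathcal R^{\mathrm{lat}}_\ell=c_\ell\, d\log\Big(1+\frac{\sigma_{\ell+1}^2}{\sigma_\ell^2}\Big),\quad c_\ell=\frac{\sigma_{\ell+1}^2\,\sigma_{\max}^{2\ell}}{\log(1+\sigma_{\ell+1}^2)}.$$ (2) Moreover, $\mathcal{BR}(n)=\tilde{\mathcal O}\Big(\sqrt{n\big(dK\sigma_1^2+d\sum_{\ell=1}^L\sigma_{\ell+1}^2\sigma_{\max}^{2\ell}\big)}\Big)$: there are $C>0$ and $k\in\mathbb N$, depending only on $L,\sigma,\sigma_1,\dots,\sigma_{L+1}$ (so not on $K$, $d$, the $W_\ell$, the contexts or $n$), such that for all $n\ge2$ $$\mathcal{BR}(n)\le C(\log n)^k\sqrt{n\Big(dK\sigma_1^2+d\sum_{\ell=1}^L\sigma_{\ell+1}^2\sigma_{\max}^{2\ell}\Big)}.$$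 -/

import Mathlib

open MeasureTheory ProbabilityTheory
open scoped RealInnerProductSpace ENNReal NNReal

namespace DiffusionTS

/-- Contexts, latent parameters and the parameter of one action live in `ℝ^d`. -/
abbrev Vec (d : ℕ) : Type := EuclideanSpace ℝ (Fin d)

/-- The parameters `θ = (θ_a)_{a ∈ [K]}` of all actions. -/
abbrev Params (d K : ℕ) : Type := Fin K → Vec d

/-- What is recorded in one round: the context, the action taken, the reward. -/
abbrev Round (d K : ℕ) : Type := Vec d × Fin K × ℝ

/-- The interactions of the first `t` rounds, oldest first. -/
abbrev History (d K t : ℕ) : Type := Fin t → Round d K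

/-- A diffusion prior with `L` latent layers and Gaussian noise, together with the noise level of
the rewards. The link functions `f ℓ` are used for `1 ≤ ℓ ≤ L`, the covariances `S ℓ` for
`1 ≤ ℓ ≤ L + 1`. -/
structure Model (d : ℕ) where
  L : ℕ
  f : ℕ → Vec d → Vec d
  S : ℕ → Matrix (Fin d) (Fin d) ℝ
  σ : ℝ

/-- The model with linear links `ψ ↦ W_ℓ ψ`, covariances `s_ℓ² I_d` and reward noise `σ²`. -/
noncomputable def linearModel {d : ℕ} (L : ℕ) (W : ℕ → Matrix (Fin d) (Fin d) ℝ) (s : ℕ → ℝ)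
    (σ : ℝ) : Model d where
  L := L
  f := fun ℓ ψ => Matrix.toEuclideanCLM (𝕜 := ℝ) (W ℓ) ψ
  S := fun ℓ => (s ℓ) ^ 2 • (1 : Matrix (Fin d) (Fin d) ℝ)
  σ := σ

/-- Rescaling of a measure to total mass one. -/
noncomputable def normalize {α : Type*} [MeasurableSpace α] (μ : Measure α) : Measure α :=
  (μ Set.univ)⁻¹ • μ

/-- The least maximiser of `g` over the actions. -/
noncomputable def argmax {K : ℕ} [NeZero K] (g : Fin K → ℝ) : Fin K :=
  (Finset.univ.filter fun a => ∀ b, g b ≤ g a).min' (by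
    obtain ⟨a, ha⟩ := Finite.exists_max g
    exact ⟨a, by simpa using ha⟩)

namespace Model

variable {d K : ℕ} (M : Model d)

/-- The reward variance `σ²`. -/
noncomputable def noiseVar : ℝ≥0 := Real.toNNReal (M.σ ^ 2)

/-- The reward distribution `P(· ∣ x; θ_a) = N(xᵀ θ_a, σ²)` of an action with parameter `θ_a`. -/
noncomputable def rewardLaw (x θa : Vec d) : Measure ℝ := gaussianReal ⟪x, θa⟫ M.noiseVar

/-- The density of `rewardLaw` with respect to Lebesgue measure. -/
noncomputable def rewardPDF (x θa : Vec d) (y : ℝ) : ℝ≥0∞ := gaussianPDF ⟪x, θa⟫ M.noiseVar y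

/-- The expected reward `r(x, a; θ)`. -/
noncomputable def meanReward (x : Vec d) (a : Fin K) (θ : Params d K) : ℝ :=
  ∫ y, y ∂(M.rewardLaw x (θ a))

/-- `argmax_a r(x, a; θ)`. -/
noncomputable def bestAction [NeZero K] (x : Vec d) (θ : Params d K) : Fin K :=
  argmax fun a => M.meanReward x a θ

/-- Prior transition: the law `N(f_ℓ(ψ_ℓ), Σ_ℓ)` of `ψ_{ℓ-1}` given `ψ_ℓ = ψ` (`ℓ ≥ 2`), and of
each `θ_a` given `ψ_1 = ψ` (`ℓ = 1`). -/
noncomputable def layer (ℓ : ℕ) (ψ : Vec d) : Measure (Vec d) :=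
  multivariateGaussian (M.f ℓ ψ) (M.S ℓ)

/-- The prior law `N(0, Σ_{L+1})` of `ψ_L`. -/
noncomputable def top : Measure (Vec d) := multivariateGaussian 0 (M.S (M.L + 1))

end Model

/-- Hierarchical sampling of `θ` from a value `ψ` of layer `ℓ`: draw `ψ_{ℓ-1} ∼ trans ℓ ψ`, then
`ψ_{ℓ-2}` and so on down to `ψ_1`, and finally the `θ_a ∼ act a ψ_1` independently over `a`.
There is no layer `0`. -/
noncomputable def descend {d K : ℕ} (trans : ℕ → Vec d → Measure (Vec d))
    (act : Fin K → Vec d → Measure (Vec d)) : ℕ → Vec d → Measure (Params d K)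
  | 0, _ => 0
  | 1, ψ => Measure.pi fun a => act a ψ
  | ℓ + 2, ψ => (trans (ℓ + 2) ψ).bind (descend trans act (ℓ + 1))

namespace Model

variable {d K : ℕ} (M : Model d)

/-- The prior law of `θ`: `ψ_L ∼ N(0, Σ_{L+1})`, `ψ_{ℓ-1} ∣ ψ_ℓ ∼ N(f_ℓ(ψ_ℓ), Σ_ℓ)`, and, given
`ψ_1`, independent `θ_a ∼ N(f_1(ψ_1), Σ_1)`. -/
noncomputable def prior (K : ℕ) : Measure (Params d K) :=
  M.top.bind (descend M.layer (fun _ => M.layer 1) M.L)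

/-- The likelihood of the rewards observed with action `a`, as a function of `θ_a`. -/
noncomputable def actionLik {t : ℕ} (h : History d K t) (a : Fin K) (θa : Vec d) : ℝ≥0∞ :=
  ∏ i ∈ Finset.univ.filter (fun i => (h i).2.1 = a), M.rewardPDF (h i).1 θa (h i).2.2

/-- The likelihood `p(H_t ∣ ψ_ℓ = ψ)`, by recursion on the layer `ℓ ≥ 1`. -/
noncomputable def latentLik {t : ℕ} (h : History d K t) : ℕ → Vec d → ℝ≥0∞
  | 0, _ => 0
  | 1, ψ => ∏ a : Fin K, ∫⁻ θa, M.actionLik h a θa ∂(M.layer 1 ψ)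
  | ℓ + 2, ψ => ∫⁻ φ, latentLik h (ℓ + 1) φ ∂(M.layer (ℓ + 2) ψ)

/-- The conditional action posterior `p(θ_a ∣ ψ_1, H_{t,a})`. -/
noncomputable def actionPosterior {t : ℕ} (h : History d K t) (a : Fin K) (ψ : Vec d) :
    Measure (Vec d) :=
  normalize ((M.layer 1 ψ).withDensity (M.actionLik h a))

/-- The conditional latent posterior `p(ψ_{ℓ-1} ∣ ψ_ℓ, H_t)`, for `ℓ ≥ 2`. -/
noncomputable def latentPosterior {t : ℕ} (h : History d K t) (ℓ : ℕ) (ψ : Vec d) :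
    Measure (Vec d) :=
  normalize ((M.layer ℓ ψ).withDensity (M.latentLik h (ℓ - 1)))

/-- The posterior `p(ψ_L ∣ H_t)` of the top layer. -/
noncomputable def topPosterior {t : ℕ} (h : History d K t) : Measure (Vec d) :=
  normalize (M.top.withDensity (M.latentLik h M.L))

/-- The law of the parameters `θ_t` sampled hierarchically by diffusion Thompson sampling after
the history `h`. -/
noncomputable def sampleLaw {t : ℕ} (h : History d K t) : Measure (Params d K) :=
  (M.topPosterior h).bind (descend (M.latentPosterior h) (M.actionPosterior h) M.L)

/-- The joint law of the true parameters `θ` and of the first `t` rounds when diffusion Thompson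
sampling is run. In each round the context is drawn from `ctx` given the history, `θ'` is sampled
given the history, the action is greedy for `θ'`, and the reward is drawn from the reward
distribution of that action under `θ`. -/
noncomputable def runLaw [NeZero K] (ctx : (t : ℕ) → Kernel (History d K t) (Vec d)) :
    (t : ℕ) → Measure (Params d K × History d K t)
  | 0 => (M.prior K).map fun θ => (θ, Fin.elim0)
  | t + 1 => (runLaw ctx t).bind fun p =>
      (ctx t p.2).bind fun x =>
        (M.sampleLaw p.2).bind fun θ' =>
          (M.rewardLaw x (p.1 (M.bestAction x θ'))).map fun y =>
            (p.1, (Fin.snoc p.2 (x, M.bestAction x θ', y) : History d K (t + 1)))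

/-- The regret `∑_t r(X_t, A_{t,*}; θ) - r(X_t, A_t; θ)` of a history under the parameters `θ`. -/
noncomputable def regret [NeZero K] {n : ℕ} (p : Params d K × History d K n) : ℝ :=
  ∑ t : Fin n, (M.meanReward (p.2 t).1 (M.bestAction (p.2 t).1 p.1) p.1
    - M.meanReward (p.2 t).1 (p.2 t).2.1 p.1)

/-- The Bayes regret of diffusion Thompson sampling over `n` rounds. -/
noncomputable def bayesRegret [NeZero K] (ctx : (t : ℕ) → Kernel (History d K t) (Vec d))
    (n : ℕ) : ℝ :=
  ∫ p, M.regret p ∂(M.runLaw ctx n)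

end Model

/-- Every mixing matrix satisfies `λ_1(W_ℓᵀ W_ℓ) = 1`. -/
def UnitMixing {d : ℕ} (L : ℕ) (W : ℕ → Matrix (Fin d) (Fin d) ℝ) : Prop :=
  ∀ ℓ ∈ Finset.Icc 1 L,
    IsGreatest {r : ℝ | Module.End.HasEigenvalue (Matrix.toLin' ((W ℓ).transpose * W ℓ)) r} 1

/-- All contexts have Euclidean norm one. -/
def UnitContexts {d K : ℕ} (ctx : (t : ℕ) → Kernel (History d K t) (Vec d)) : Prop :=
  ∀ t (h : History d K t), ∀ᵐ x ∂(ctx t h), ‖x‖ ^ 2 = 1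

/-- `σ_max² = max_{ℓ ∈ [L+1]} (1 + σ_ℓ² / σ²)`. -/
noncomputable def sigmaMaxSq (L : ℕ) (s : ℕ → ℝ) (σ : ℝ) : ℝ :=
  (Finset.Icc 1 (L + 1)).sup' (Finset.nonempty_Icc.2 (Nat.le_add_left 1 L))
    fun ℓ => 1 + s ℓ ^ 2 / σ ^ 2

/-- The action term `R^act(n) = c_0 d K log(1 + n σ_1² / d)`. -/
noncomputable def actTerm (d K n : ℕ) (s : ℕ → ℝ) : ℝ :=
  (s 1 ^ 2 / Real.log (1 + s 1 ^ 2)) * d * K * Real.log (1 + n * s 1 ^ 2 / d)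

/-- The latent term `R_ℓ^lat = c_ℓ d log(1 + σ_{ℓ+1}² / σ_ℓ²)`. -/
noncomputable def latTerm (d L : ℕ) (s : ℕ → ℝ) (σ : ℝ) (ℓ : ℕ) : ℝ :=
  (s (ℓ + 1) ^ 2 * sigmaMaxSq L s σ ^ ℓ / Real.log (1 + s (ℓ + 1) ^ 2)) * d
    * Real.log (1 + s (ℓ + 1) ^ 2 / s ℓ ^ 2)

end DiffusionTS

/-!
The regret of one round is compared with the posterior variance of the action played, and the sum of
these variances with the information the rewards carry about the parameters.

*The sampling law is the posterior.* Multiplying a product of conditional laws by a likelihood and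
renormalising commutes with drawing layer by layer (`bind_normalize_withDensity`), so the
hierarchical sampling law is the prior weighted by the likelihood of the history (`sampleLaw_eq`).
By Bayes' formula for one more reward and induction on the rounds, given the history, the true
parameters and freshly sampled ones have the same law (`lintegral_runLaw_eq_sampleLaw`).

*The posterior is Gaussian.* Unrolling the hierarchy, the prior is the image under a linear map `T`
of white noise `z` with `d (K + L)` coordinates; since the mixing matrices do not increase norms,
`xᵀ θ_a` has prior variance at most `γ = ∑ σ_ℓ²` for `‖x‖ = 1` (`exists_prior_eq_map`). Given a
history, `z` has a Lebesgue density proportional to `exp (-zᵀPz/2 + bᵀz)`, where `P` is the identity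
plus `σ⁻²` times the sum of the `w wᵀ` over the observed features `w`. Translation invariance then
shows that `wᵀz` is sub-Gaussian with variance proxy `wᵀP⁻¹w`
(`exists_hasSubgaussianMGF_sampleLaw`).

*One round.* Let `A*` be the optimal and `A` the played action. Given the history and the context
they have the same law, and `A` is independent of the true parameters, so the expected regret is
that of `xᵀθ_{A*}` minus its posterior mean. The tangent of the logarithm at `K`, combined with the
moment generating functions, bounds it by `log K / r + (r / 2) E[posterior variance at A]` for every
`r > 0` (`integral_sub_le_of_hasSubgaussianMGF`, `lintegral_regret_le`).

*Summation.* Playing an action with posterior variance `q` multiplies `det P` by `1 + q / σ²`, and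
`q ≤ (σ² + γ) log (1 + q / σ²)` as `q ≤ γ`. Hence the sum of the posterior variances is at most
`(σ² + γ) log det P`, which the trace of `P` bounds by a multiple of `d K log (1 + n σ_1² / d)`
(`log_det_precision_le`, `gain_le`); it is also at most `n γ`. Optimising over `r` gives
`BR(n) ≤ √(2 n Q V)` with `Q = log K + 1`, for `V` either of the two bounds.

*The two claims.* With `V ≤ C R^act(n)`, the term `c n δ` of the first claim, where
`c = √(2 γ Q) exp (C Q)`, exceeds the bound linear in `n` when `log (1 / δ) < C Q`; otherwise the
square root exceeds `√(2 n Q V)`. For the second claim, `log K ≤ log n` if `K ≤ n`, and if `K > n`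
the bound linear in `n` is small enough, because `n log K ≤ n log n + K`.
-/

namespace DiffusionTS

/-! ### Densities on finite products -/

theorem lintegral_fin_prod_pi {n : ℕ} {E : Type*} [MeasurableSpace E] {μ : Fin n → Measure E}
    [∀ i, SigmaFinite (μ i)] {f : Fin n → E → ℝ≥0∞} (hf : ∀ i, Measurable (f i)) :
    ∫⁻ x, ∏ i, f i (x i) ∂(Measure.pi μ) = ∏ i, ∫⁻ x, f i x ∂(μ i) := by
  induction n with
  | zero => simp
  | succ n ih =>
    rw [← ((measurePreserving_piFinSuccAbove μ 0).symm).lintegral_comp_emb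
      (MeasurableEquiv.measurableEmbedding _)]
    simp_rw [MeasurableEquiv.piFinSuccAbove_symm_apply, Fin.insertNthEquiv,
      Fin.prod_univ_succ, Fin.insertNth_zero, Equiv.coe_fn_mk, Fin.cons_succ,
      Fin.zero_succAbove, cast_eq, Fin.cons_zero]
    rw [← ih (fun i => hf i.succ), ← lintegral_prod_mul (hf 0).aemeasurable]
    exact (Finset.measurable_prod _ fun i _ =>
      (hf i.succ).comp (measurable_pi_apply i)).aemeasurable

/-- Tonelli's theorem for a product of functions of the coordinates. -/
theorem lintegral_prod_pi {ι E : Type*} [Fintype ι] [MeasurableSpace E] {μ : ι → Measure E}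
    [∀ i, SigmaFinite (μ i)] {f : ι → E → ℝ≥0∞} (hf : ∀ i, Measurable (f i)) :
    ∫⁻ x, ∏ i, f i (x i) ∂(Measure.pi μ) = ∏ i, ∫⁻ x, f i x ∂(μ i) := by
  let e := (Fintype.equivFin ι).symm
  rw [← (measurePreserving_piCongrLeft (fun i => μ i) e).lintegral_comp_emb
      (MeasurableEquiv.measurableEmbedding _)]
  simp_rw [← e.prod_comp, MeasurableEquiv.coe_piCongrLeft, Equiv.piCongrLeft_apply_apply]
  exact lintegral_fin_prod_pi fun i => hf (e i)

theorem setLIntegral_prod_pi {ι E : Type*} [Fintype ι] [MeasurableSpace E] {μ : ι → Measure E}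
    [∀ i, SigmaFinite (μ i)] {f : ι → E → ℝ≥0∞} (hf : ∀ i, Measurable (f i)) (s : ι → Set E) :
    ∫⁻ x in Set.univ.pi s, ∏ i, f i (x i) ∂(Measure.pi μ) = ∏ i, ∫⁻ x in s i, f i x ∂(μ i) := by
  rw [Measure.restrict_pi_pi, lintegral_prod_pi hf]

theorem normalize_withDensity {α : Type*} [MeasurableSpace α] (μ : Measure α) (f : α → ℝ≥0∞) :
    normalize (μ.withDensity f) = (∫⁻ x, f x ∂μ)⁻¹ • μ.withDensity f := by
  simp [normalize, withDensity_apply]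

theorem isProbabilityMeasure_normalize {α : Type*} [MeasurableSpace α] {μ : Measure α}
    (h0 : μ Set.univ ≠ 0) (h1 : μ Set.univ ≠ ∞) : IsProbabilityMeasure (normalize μ) :=
  ⟨by simp [normalize, ENNReal.inv_mul_cancel h0 h1]⟩

/-- Weighting each factor of a product by a density and rescaling it amounts to doing the same
with the product of the densities. -/
theorem pi_normalize_withDensity {ι E : Type*} [Fintype ι] [MeasurableSpace E]
    {μ : ι → Measure E} [∀ i, IsProbabilityMeasure (μ i)] {f : ι → E → ℝ≥0∞}
    (hf : ∀ i, Measurable (f i)) (h0 : ∀ i, ∫⁻ x, f i x ∂(μ i) ≠ 0)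
    (h1 : ∀ i, ∫⁻ x, f i x ∂(μ i) ≠ ∞) :
    Measure.pi (fun i => normalize ((μ i).withDensity (f i)))
      = (∏ i, ∫⁻ x, f i x ∂(μ i))⁻¹ • (Measure.pi μ).withDensity fun x => ∏ i, f i (x i) := by
  have hp : ∀ i, IsProbabilityMeasure (normalize ((μ i).withDensity (f i))) := fun i =>
    isProbabilityMeasure_normalize (by simpa using h0 i) (by simpa using h1 i)
  refine Measure.pi_eq fun s hs => ?_
  rw [Measure.smul_apply, withDensity_apply _ (MeasurableSet.univ_pi hs), setLIntegral_prod_pi hf,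
    smul_eq_mul, ENNReal.prod_inv_distrib fun i _ j _ _ => Or.inl (h0 i),
    ← Finset.prod_mul_distrib]
  refine Finset.prod_congr rfl fun i _ => ?_
  rw [normalize_withDensity, Measure.smul_apply, withDensity_apply _ (hs i), smul_eq_mul]

/-! ### Measurable families of measures -/

theorem measurable_bind_prod {α β γ : Type*} [MeasurableSpace α] [MeasurableSpace β]
    [MeasurableSpace γ] {κ : α → Measure β} (hκ : Measurable κ) [∀ a, IsProbabilityMeasure (κ a)]
    {g : α → β → Measure γ} (hg : Measurable (Function.uncurry g)) :
    Measurable fun a => (κ a).bind (g a) := by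
  let k : Kernel α β := ⟨κ, hκ⟩
  have : IsMarkovKernel k := ⟨fun a => inferInstanceAs (IsProbabilityMeasure (κ a))⟩
  refine Measure.measurable_of_measurable_coe _ fun s hs => ?_
  have h : ∀ a, ((κ a).bind (g a)) s = ∫⁻ b, g a b s ∂(k a) := fun a =>
    Measure.bind_apply hs (hg.comp measurable_prodMk_left).aemeasurable
  simp_rw [h]
  exact Measurable.lintegral_kernel_prod_right (f := fun a b => g a b s)
    ((Measure.measurable_coe hs).comp hg)

theorem measurable_map_prod {α β γ : Type*} [MeasurableSpace α] [MeasurableSpace β]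
    [MeasurableSpace γ] {κ : α → Measure β} (hκ : Measurable κ) [∀ a, IsProbabilityMeasure (κ a)]
    {g : α → β → γ} (hg : Measurable (Function.uncurry g)) :
    Measurable fun a => (κ a).map (g a) := by
  have h : ∀ a, (κ a).map (g a) = (κ a).bind fun b => Measure.dirac (g a b) := fun a =>
    (Measure.bind_dirac_eq_map _ (hg.comp measurable_prodMk_left)).symm
  simp_rw [h]
  exact measurable_bind_prod hκ (Measure.measurable_dirac.comp hg)

theorem measurable_pi_measure {α ι E : Type*} [Fintype ι] [MeasurableSpace α] [MeasurableSpace E]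
    {κ : ι → α → Measure E} (hκ : ∀ i, Measurable (κ i)) [∀ i a, IsProbabilityMeasure (κ i a)] :
    Measurable fun a => Measure.pi fun i => κ i a := by
  refine Measurable.measure_of_isPiSystem_of_isProbabilityMeasure generateFrom_pi.symm
    isPiSystem_pi ?_
  rintro _ ⟨s, hs, rfl⟩
  simp_rw [Measure.pi_pi]
  exact Finset.measurable_prod _ fun i _ =>
    (Measure.measurable_coe (hs i (Set.mem_univ i))).comp (hκ i)

theorem isProbabilityMeasure_bind' {α β : Type*} [MeasurableSpace α] [MeasurableSpace β]
    {μ : Measure α} [IsProbabilityMeasure μ] {κ : α → Measure β} (hκ : Measurable κ)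
    (h : ∀ a, IsProbabilityMeasure (κ a)) : IsProbabilityMeasure (μ.bind κ) :=
  ⟨by simp [Measure.bind_apply MeasurableSet.univ hκ.aemeasurable]⟩

/-- Drawing from the posterior of the first stage and then from the posterior of the second stage
given the first is the same as drawing from the posterior of the outcome of both stages. -/
theorem bind_normalize_withDensity {α β : Type*} [MeasurableSpace α] [MeasurableSpace β]
    {μ : Measure α} {κ κ' : α → Measure β} (hκ : Measurable κ) {g : β → ℝ≥0∞} (hg : Measurable g)
    (h0 : ∀ a, ∫⁻ b, g b ∂(κ a) ≠ 0) (h1 : ∀ a, ∫⁻ b, g b ∂(κ a) ≠ ∞)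
    (hκ' : ∀ a, κ' a = (∫⁻ b, g b ∂(κ a))⁻¹ • (κ a).withDensity g) :
    (normalize (μ.withDensity fun a => ∫⁻ b, g b ∂(κ a))).bind κ'
      = (∫⁻ b, g b ∂(μ.bind κ))⁻¹ • (μ.bind κ).withDensity g := by
  have hZ : Measurable fun a => ∫⁻ b, g b ∂(κ a) := (Measure.measurable_lintegral hg).comp hκ
  have hs : ∀ s, MeasurableSet s → Measurable fun a => ∫⁻ b in s, g b ∂(κ a) := fun s hs => by
    simp_rw [← lintegral_indicator hs]
    exact (Measure.measurable_lintegral (hg.indicator hs)).comp hκ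
  have hm : Measurable κ' := by
    refine Measure.measurable_of_measurable_coe _ fun s hms => ?_
    simp_rw [hκ', Measure.smul_apply, withDensity_apply _ hms, smul_eq_mul]
    exact hZ.inv.mul (hs s hms)
  ext s hms
  have hm' : Measurable fun a => κ' a s := (Measure.measurable_coe hms).comp hm
  rw [Measure.bind_apply hms hm.aemeasurable, normalize_withDensity, lintegral_smul_measure,
    lintegral_withDensity_eq_lintegral_mul _ hZ hm',
    Measure.smul_apply, withDensity_apply _ hms, ← lintegral_indicator hms,
    Measure.lintegral_bind hκ.aemeasurable hg.aemeasurable,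
    Measure.lintegral_bind hκ.aemeasurable (hg.indicator hms).aemeasurable]
  congr 1
  refine lintegral_congr fun a => ?_
  rw [lintegral_indicator hms, Pi.mul_apply, hκ', Measure.smul_apply, withDensity_apply _ hms,
    smul_eq_mul, ← mul_assoc, ENNReal.mul_inv_cancel (h0 a) (h1 a), one_mul]

/-! ### The sampling law of the algorithm is the posterior -/

namespace Model

variable {d K : ℕ} (M : Model d)

/-- The likelihood of all rewards of a history, as a function of all action parameters. -/
noncomputable def lik {t : ℕ} (h : History d K t) (θ : Params d K) : ℝ≥0∞ :=
  ∏ i, M.rewardPDF (h i).1 (θ (h i).2.1) (h i).2.2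

theorem prod_actionLik {t : ℕ} (h : History d K t) (θ : Params d K) :
    ∏ a, M.actionLik h a (θ a) = M.lik h θ := by
  unfold actionLik lik
  rw [← Finset.prod_fiberwise (s := Finset.univ) (g := fun i => (h i).2.1)]
  refine Finset.prod_congr rfl fun a _ => Finset.prod_congr rfl fun i hi => ?_
  rw [(Finset.mem_filter.1 hi).2]

theorem measurable_rewardPDF {α : Type*} [MeasurableSpace α] {f g : α → Vec d} {y : α → ℝ}
    (hf : Measurable f) (hg : Measurable g) (hy : Measurable y) :
    Measurable fun a => M.rewardPDF (f a) (g a) (y a) := by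
  have h : Measurable fun a => ((⟪f a, g a⟫ : ℝ), M.noiseVar, y a) :=
    (hf.inner hg).prodMk (measurable_const.prodMk hy)
  exact measurable_uncurry_gaussianPDF.comp h

theorem measurable_eval_params {α : Type*} [MeasurableSpace α] {f : α → Params d K}
    (hf : Measurable f) {a : α → Fin K} (ha : Measurable a) : Measurable fun x => f x (a x) := by
  have h : Measurable fun p : Params d K × Fin K => p.1 p.2 :=
    measurable_from_prod_countable_left fun a => measurable_pi_apply a
  exact h.comp (hf.prodMk ha)

theorem measurable_lik_comp {α : Type*} [MeasurableSpace α] {t : ℕ} {h : α → History d K t}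
    {θ : α → Params d K} (hh : Measurable h) (hθ : Measurable θ) :
    Measurable fun a => M.lik (h a) (θ a) := by
  unfold lik
  refine Finset.measurable_fun_prod _ fun i _ => ?_
  have h1 : Measurable fun a => h a i := (measurable_pi_apply i).comp hh
  exact M.measurable_rewardPDF h1.fst (measurable_eval_params hθ h1.snd.fst) h1.snd.snd

theorem measurable_lik {t : ℕ} :
    Measurable fun p : History d K t × Params d K => M.lik p.1 p.2 :=
  M.measurable_lik_comp measurable_fst measurable_snd

theorem measurable_lik_right {t : ℕ} (h : History d K t) : Measurable (M.lik h) :=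
  Finset.measurable_fun_prod _ fun i _ =>
    M.measurable_rewardPDF measurable_const (measurable_pi_apply (h i).2.1) measurable_const

theorem measurable_actionLik {t : ℕ} (h : History d K t) (a : Fin K) :
    Measurable (M.actionLik h a) := by
  unfold actionLik
  exact Finset.measurable_fun_prod _ fun i _ =>
    M.measurable_rewardPDF measurable_const measurable_id measurable_const

variable {M}

theorem rewardPDF_ne_zero (hσ : M.noiseVar ≠ 0) (x θa : Vec d) (y : ℝ) :
    M.rewardPDF x θa y ≠ 0 := (gaussianPDF_pos _ hσ y).ne'

theorem rewardPDF_le (x θa : Vec d) (y : ℝ) :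
    M.rewardPDF x θa y ≤ ENNReal.ofReal (√(2 * Real.pi * M.noiseVar))⁻¹ := by
  refine ENNReal.ofReal_le_ofReal ?_
  rw [gaussianPDFReal]
  refine mul_le_of_le_one_right (by positivity) (Real.exp_le_one_iff.2 ?_)
  exact div_nonpos_of_nonpos_of_nonneg (neg_nonpos.2 (sq_nonneg _)) (by positivity)

theorem lik_ne_zero (hσ : M.noiseVar ≠ 0) {t : ℕ} (h : History d K t) (θ : Params d K) :
    M.lik h θ ≠ 0 := Finset.prod_ne_zero_iff.2 fun _ _ => rewardPDF_ne_zero hσ _ _ _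

theorem actionLik_ne_zero (hσ : M.noiseVar ≠ 0) {t : ℕ} (h : History d K t) (a : Fin K)
    (θa : Vec d) : M.actionLik h a θa ≠ 0 :=
  Finset.prod_ne_zero_iff.2 fun _ _ => rewardPDF_ne_zero hσ _ _ _

theorem lintegral_ne_zero_of_ne_zero {α : Type*} [MeasurableSpace α] {μ : Measure α}
    [IsProbabilityMeasure μ] {g : α → ℝ≥0∞} (hg : Measurable g) (h : ∀ x, g x ≠ 0) :
    ∫⁻ x, g x ∂μ ≠ 0 := by
  rw [Ne, lintegral_eq_zero_iff hg]
  intro h0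
  obtain ⟨x, hx⟩ := h0.exists
  exact h x hx

theorem lintegral_ne_top_of_le {α : Type*} [MeasurableSpace α] {μ : Measure α}
    [IsProbabilityMeasure μ] {g : α → ℝ≥0∞} {c : ℝ≥0∞} (hc : c ≠ ∞) (h : ∀ x, g x ≤ c) :
    ∫⁻ x, g x ∂μ ≠ ∞ :=
  ((lintegral_mono h).trans_lt (by simpa using hc.lt_top)).ne

theorem lintegral_lik_ne_zero (hσ : M.noiseVar ≠ 0) {t : ℕ} (h : History d K t)
    (μ : Measure (Params d K)) [IsProbabilityMeasure μ] : ∫⁻ θ, M.lik h θ ∂μ ≠ 0 :=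
  lintegral_ne_zero_of_ne_zero (M.measurable_lik_right h) (lik_ne_zero hσ h)

theorem lintegral_lik_ne_top {t : ℕ} (h : History d K t)
    (μ : Measure (Params d K)) [IsProbabilityMeasure μ] : ∫⁻ θ, M.lik h θ ∂μ ≠ ∞ :=
  lintegral_ne_top_of_le (ENNReal.pow_ne_top (n := Fintype.card (Fin t)) ENNReal.ofReal_ne_top)
    fun _ => Finset.prod_le_pow_card _ _ _ fun _ _ => rewardPDF_le _ _ _

theorem lintegral_actionLik_ne_top {t : ℕ} (h : History d K t) (a : Fin K)
    (μ : Measure (Vec d)) [IsProbabilityMeasure μ] : ∫⁻ θ, M.actionLik h a θ ∂μ ≠ ∞ :=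
  lintegral_ne_top_of_le (ENNReal.pow_ne_top ENNReal.ofReal_ne_top)
    fun _ => Finset.prod_le_pow_card _ _ _ fun _ _ => rewardPDF_le _ _ _

instance (ℓ : ℕ) (ψ : Vec d) : IsProbabilityMeasure (M.layer ℓ ψ) := by
  unfold layer; infer_instance

instance : IsProbabilityMeasure M.top := by
  unfold top; infer_instance

theorem measurable_layer (hf : ∀ ℓ, Measurable (M.f ℓ)) (ℓ : ℕ) : Measurable (M.layer ℓ) := by
  refine measurable_map_prod (κ := fun _ => stdGaussian (Vec d)) measurable_const ?_
  exact ((hf ℓ).comp measurable_fst).add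
    ((ContinuousLinearMap.measurable _).comp measurable_snd)

theorem measurable_descend (hf : ∀ ℓ, Measurable (M.f ℓ)) (ℓ : ℕ) :
    Measurable (descend (K := K) M.layer (fun _ => M.layer 1) (ℓ + 1)) ∧
      ∀ ψ, IsProbabilityMeasure (descend (K := K) M.layer (fun _ => M.layer 1) (ℓ + 1) ψ) := by
  induction ℓ with
  | zero =>
    refine ⟨measurable_pi_measure (fun _ => measurable_layer hf 1), fun ψ => ?_⟩
    simp only [descend]
    infer_instance
  | succ ℓ ih =>
    refine ⟨(Measure.measurable_bind' ih.1).comp (measurable_layer hf (ℓ + 2)), fun ψ => ?_⟩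
    exact isProbabilityMeasure_bind' ih.1 ih.2

theorem latentLik_eq (hf : ∀ ℓ, Measurable (M.f ℓ)) {t : ℕ} (h : History d K t) (ℓ : ℕ)
    (ψ : Vec d) : M.latentLik h (ℓ + 1) ψ
      = ∫⁻ θ, M.lik h θ ∂(descend M.layer (fun _ => M.layer 1) (ℓ + 1) ψ) := by
  induction ℓ generalizing ψ with
  | zero =>
    simp only [latentLik, descend, ← prod_actionLik]
    rw [lintegral_prod_pi fun a => M.measurable_actionLik h a]
  | succ ℓ ih =>
    simp only [latentLik, descend]
    rw [Measure.lintegral_bind (measurable_descend hf ℓ).1.aemeasurable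
      (M.measurable_lik_right h).aemeasurable]
    exact lintegral_congr fun φ => ih φ

/-- The hierarchical posterior below a latent value is the prior below that value, weighted by
the likelihood. -/
theorem descend_posterior_eq (hf : ∀ ℓ, Measurable (M.f ℓ)) (hσ : M.noiseVar ≠ 0) {t : ℕ}
    (h : History d K t) (ℓ : ℕ) (ψ : Vec d) :
    descend (M.latentPosterior h) (M.actionPosterior h) (ℓ + 1) ψ
      = (∫⁻ θ, M.lik h θ ∂(descend M.layer (fun _ => M.layer 1) (ℓ + 1) ψ))⁻¹
        • (descend M.layer (fun _ => M.layer 1) (ℓ + 1) ψ).withDensity (M.lik h) := by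
  induction ℓ generalizing ψ with
  | zero =>
    have e : M.lik h = fun θ => ∏ a, M.actionLik h a (θ a) :=
      funext fun θ => (M.prod_actionLik h θ).symm
    simp only [descend, actionPosterior, e]
    rw [pi_normalize_withDensity (fun a => M.measurable_actionLik h a)
      (fun a => lintegral_ne_zero_of_ne_zero (M.measurable_actionLik h a)
        (actionLik_ne_zero hσ h a)) fun a => lintegral_actionLik_ne_top h a _,
      lintegral_prod_pi fun a => M.measurable_actionLik h a]
  | succ ℓ ih =>
    simp only [descend, latentPosterior]
    have hp := fun ψ => (measurable_descend (K := K) hf ℓ).2 ψ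
    have e : M.latentLik h (ℓ + 2 - 1) = fun φ => ∫⁻ θ, M.lik h θ
        ∂(descend M.layer (fun _ => M.layer 1) (ℓ + 1) φ) := funext fun φ => latentLik_eq hf h ℓ φ
    rw [e]
    exact bind_normalize_withDensity (measurable_descend hf ℓ).1 (M.measurable_lik_right h)
      (fun φ => lintegral_lik_ne_zero hσ h _) (fun φ => lintegral_lik_ne_top h _) ih

theorem isProbabilityMeasure_prior (hf : ∀ ℓ, Measurable (M.f ℓ)) (hL : 1 ≤ M.L) :
    IsProbabilityMeasure (M.prior K) := by
  obtain ⟨ℓ, hℓ⟩ := Nat.exists_eq_add_of_le' hL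
  unfold prior
  rw [hℓ]
  exact isProbabilityMeasure_bind' (measurable_descend hf ℓ).1 (measurable_descend hf ℓ).2

/-- The hierarchically sampled parameters follow the posterior of the parameters: the prior
weighted by the likelihood of the history. -/
theorem sampleLaw_eq (hf : ∀ ℓ, Measurable (M.f ℓ)) (hσ : M.noiseVar ≠ 0) (hL : 1 ≤ M.L)
    {t : ℕ} (h : History d K t) :
    M.sampleLaw h = (∫⁻ θ, M.lik h θ ∂(M.prior K))⁻¹ • (M.prior K).withDensity (M.lik h) := by
  obtain ⟨ℓ, hℓ⟩ := Nat.exists_eq_add_of_le' hL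
  have hp := fun ψ => (measurable_descend (K := K) hf ℓ).2 ψ
  have e : M.latentLik h (ℓ + 1) = fun φ => ∫⁻ θ, M.lik h θ
      ∂(descend M.layer (fun _ => M.layer 1) (ℓ + 1) φ) := funext fun φ => latentLik_eq hf h ℓ φ
  unfold sampleLaw topPosterior prior
  rw [hℓ, e]
  exact bind_normalize_withDensity (measurable_descend hf ℓ).1 (M.measurable_lik_right h)
      (fun φ => lintegral_lik_ne_zero hσ h _) (fun φ => lintegral_lik_ne_top h _)
      (descend_posterior_eq hf hσ h ℓ)

theorem isProbabilityMeasure_sampleLaw (hf : ∀ ℓ, Measurable (M.f ℓ)) (hσ : M.noiseVar ≠ 0)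
    (hL : 1 ≤ M.L) {t : ℕ} (h : History d K t) : IsProbabilityMeasure (M.sampleLaw h) := by
  have := isProbabilityMeasure_prior (K := K) hf hL
  rw [sampleLaw_eq hf hσ hL, ← normalize_withDensity]
  exact isProbabilityMeasure_normalize (by simpa using lintegral_lik_ne_zero hσ h _)
    (by simpa using lintegral_lik_ne_top h _)

theorem lintegral_sampleLaw (hf : ∀ ℓ, Measurable (M.f ℓ)) (hσ : M.noiseVar ≠ 0)
    (hL : 1 ≤ M.L) {t : ℕ} (h : History d K t) {F : Params d K → ℝ≥0∞} (hF : Measurable F) :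
    ∫⁻ θ, F θ ∂(M.sampleLaw h)
      = (∫⁻ θ, M.lik h θ ∂(M.prior K))⁻¹ * ∫⁻ θ, M.lik h θ * F θ ∂(M.prior K) := by
  rw [sampleLaw_eq hf hσ hL, lintegral_smul_measure,
    lintegral_withDensity_eq_lintegral_mul _ (M.measurable_lik_right h) hF]
  rfl

theorem measurable_sampleLaw (hf : ∀ ℓ, Measurable (M.f ℓ)) (hσ : M.noiseVar ≠ 0)
    (hL : 1 ≤ M.L) {t : ℕ} :
    Measurable fun h : History d K t => M.sampleLaw h := by
  have := isProbabilityMeasure_prior (K := K) hf hL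
  refine Measure.measurable_of_measurable_coe _ fun s hs => ?_
  simp_rw [sampleLaw_eq hf hσ hL, Measure.smul_apply, withDensity_apply _ hs, smul_eq_mul]
  exact (M.measurable_lik.lintegral_prod_right').inv.mul M.measurable_lik.lintegral_prod_right'

end Model

/-! ### Greedy actions -/

theorem argmax_spec {K : ℕ} [NeZero K] (g : Fin K → ℝ) (b : Fin K) : g b ≤ g (argmax g) := by
  have h := Finset.min'_mem (Finset.univ.filter fun a => ∀ b, g b ≤ g a) (by
    obtain ⟨a, ha⟩ := Finite.exists_max g
    exact ⟨a, by simpa using ha⟩)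
  exact (Finset.mem_filter.1 h).2 b

theorem argmax_eq_iff {K : ℕ} [NeZero K] (g : Fin K → ℝ) (a : Fin K) :
    argmax g = a ↔ (∀ b, g b ≤ g a) ∧ ∀ c, (∀ b, g b ≤ g c) → a ≤ c := by
  constructor
  · rintro rfl
    exact ⟨argmax_spec g, fun c hc => Finset.min'_le _ _ (by simpa using hc)⟩
  · rintro ⟨h1, h2⟩
    exact le_antisymm (Finset.min'_le _ _ (by simpa using h1)) (h2 _ (argmax_spec g))

theorem measurable_argmax {K : ℕ} [NeZero K] : Measurable (argmax : (Fin K → ℝ) → Fin K) := by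
  refine measurable_to_countable' fun a => ?_
  have e : (argmax : (Fin K → ℝ) → Fin K) ⁻¹' {a}
      = {g | (∀ b, g b ≤ g a) ∧ ∀ c, (∀ b, g b ≤ g c) → a ≤ c} := by
    ext g
    exact argmax_eq_iff g a
  have hm : ∀ c : Fin K, Measurable fun g : Fin K → ℝ => ∀ b, g b ≤ g c := fun c =>
    Measurable.forall fun b =>
      measurableSet_setOfPred.1 (measurableSet_le (measurable_pi_apply b) (measurable_pi_apply c))
  rw [e]
  exact measurableSet_setOfPred.2 ((hm a).and (Measurable.forall fun c => (hm c).imp measurable_const))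

namespace Model

variable {d K : ℕ} {M : Model d}

theorem meanReward_eq (x : Vec d) (a : Fin K) (θ : Params d K) :
    M.meanReward x a θ = ⟪x, θ a⟫ := by
  simp [meanReward, rewardLaw, integral_id_gaussianReal]

theorem bestAction_eq [NeZero K] (x : Vec d) (θ : Params d K) :
    M.bestAction x θ = argmax fun a => (⟪x, θ a⟫ : ℝ) := by
  simp [bestAction, meanReward_eq]

theorem measurable_bestAction [NeZero K] :
    Measurable fun z : Vec d × Params d K => M.bestAction z.1 z.2 := by
  simp_rw [bestAction_eq]
  exact measurable_argmax.comp (measurable_pi_lambda _ fun a =>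
    measurable_fst.inner ((measurable_pi_apply a).comp measurable_snd))

theorem measurable_bestAction_comp [NeZero K] {α : Type*} [MeasurableSpace α] {f : α → Vec d}
    {g : α → Params d K} (hf : Measurable f) (hg : Measurable g) :
    Measurable fun a => M.bestAction (f a) (g a) := by
  simp_rw [bestAction_eq]
  exact measurable_argmax.comp (measurable_pi_lambda _ fun a =>
    hf.inner ((measurable_pi_apply a).comp hg))

theorem measurable_rewardLaw {α : Type*} [MeasurableSpace α] {f g : α → Vec d}
    (hf : Measurable f) (hg : Measurable g) : Measurable fun a => M.rewardLaw (f a) (g a) :=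
  measurable_gaussianReal.comp ((hf.inner hg).prodMk measurable_const)

instance (x θa : Vec d) : IsProbabilityMeasure (M.rewardLaw x θa) := by
  unfold rewardLaw; infer_instance

theorem lintegral_rewardLaw (hσ : M.noiseVar ≠ 0) (x θa : Vec d) {F : ℝ → ℝ≥0∞}
    (hF : Measurable F) :
    ∫⁻ y, F y ∂(M.rewardLaw x θa) = ∫⁻ y, M.rewardPDF x θa y * F y := by
  unfold rewardLaw
  rw [gaussianReal_of_var_ne_zero _ hσ,
    lintegral_withDensity_eq_lintegral_mul _ (measurable_gaussianPDF _ _) hF]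
  rfl

end Model

theorem measurable_snoc {α : Type*} [MeasurableSpace α] {d K t : ℕ} {h : α → History d K t}
    {r : α → Round d K} (hh : Measurable h) (hr : Measurable r) :
    Measurable fun a => (Fin.snoc (h a) (r a) : History d K (t + 1)) := by
  refine measurable_pi_lambda _ fun i => ?_
  refine Fin.lastCases ?_ (fun j => ?_) i
  · simpa using hr
  · simpa using (measurable_pi_apply j).fun_comp hh

namespace Model

variable {d K : ℕ} {M : Model d}

theorem lik_snoc {t : ℕ} (h : History d K t) (r : Round d K) (θ : Params d K) :
    M.lik (Fin.snoc h r : History d K (t + 1)) θ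
      = M.lik h θ * M.rewardPDF r.1 (θ r.2.1) r.2.2 := by
  simp [lik, Fin.prod_univ_castSucc]

/-! ### One round of the interaction -/

/-- The history after one more round. -/
noncomputable def extend [NeZero K] (M : Model d) {t : ℕ} (h : History d K t)
    (z : Vec d × Params d K) (y : ℝ) : History d K (t + 1) :=
  Fin.snoc h (z.1, M.bestAction z.1 z.2, y)

theorem measurable_extend [NeZero K] {α : Type*} [MeasurableSpace α] {t : ℕ}
    {h : α → History d K t} {z : α → Vec d × Params d K} {y : α → ℝ} (hh : Measurable h)
    (hz : Measurable z) (hy : Measurable y) : Measurable fun a => M.extend (h a) (z a) (y a) :=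
  measurable_snoc hh (hz.fst.prodMk ((measurable_bestAction.comp hz).prodMk hy))

/-- Standing regularity assumptions: measurable links, noisy rewards, at least one latent layer. -/
structure Regular (M : Model d) : Prop where
  measurable_f : ∀ ℓ, Measurable (M.f ℓ)
  noiseVar_ne_zero : M.noiseVar ≠ 0
  one_le_L : 1 ≤ M.L

theorem Regular.isProbabilityMeasure_sampleLaw (hM : M.Regular) {t : ℕ} (h : History d K t) :
    IsProbabilityMeasure (M.sampleLaw h) :=
  Model.isProbabilityMeasure_sampleLaw hM.1 hM.2 hM.3 h

theorem Regular.measurable_sampleLaw (hM : M.Regular) {t : ℕ} :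
    Measurable fun h : History d K t => M.sampleLaw h :=
  Model.measurable_sampleLaw hM.1 hM.2 hM.3

theorem measurable_map_rewardLaw [NeZero K] (t : ℕ) :
    Measurable fun q : ((Params d K × History d K t) × Vec d) × Params d K =>
      (M.rewardLaw q.1.2 (q.1.1.1 (M.bestAction q.1.2 q.2))).map fun y =>
        (q.1.1.1, (Fin.snoc q.1.1.2 (q.1.2, M.bestAction q.1.2 q.2, y) : History d K (t + 1))) := by
  have hz : Measurable fun q : ((Params d K × History d K t) × Vec d) × Params d K =>
      (q.1.2, q.2) := measurable_fst.snd.prodMk measurable_snd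
  refine measurable_map_prod (measurable_rewardLaw measurable_fst.snd
    (measurable_eval_params measurable_fst.fst.fst (measurable_bestAction.comp hz))) ?_
  exact measurable_fst.fst.fst.fst.prodMk
    (measurable_extend measurable_fst.fst.fst.snd (hz.comp measurable_fst) measurable_snd)

theorem Regular.measurable_step_sample [NeZero K] (hM : M.Regular) (t : ℕ) :
    Measurable fun q : (Params d K × History d K t) × Vec d =>
      (M.sampleLaw q.1.2).bind fun θ' =>
        (M.rewardLaw q.2 (q.1.1 (M.bestAction q.2 θ'))).map fun y =>
          (q.1.1, (Fin.snoc q.1.2 (q.2, M.bestAction q.2 θ', y) : History d K (t + 1))) := by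
  have := fun h : History d K t => hM.isProbabilityMeasure_sampleLaw h
  exact measurable_bind_prod (hM.measurable_sampleLaw.fun_comp measurable_fst.snd)
    (measurable_map_rewardLaw t)

/-- Integration against the joint law after one more round. -/
theorem Regular.lintegral_runLaw_succ [NeZero K] (hM : M.Regular)
    (ctx : (t : ℕ) → Kernel (History d K t) (Vec d)) [∀ t, IsMarkovKernel (ctx t)] (t : ℕ)
    {F : Params d K × History d K (t + 1) → ℝ≥0∞} (hF : Measurable F) :
    ∫⁻ p, F p ∂(M.runLaw ctx (t + 1))
      = ∫⁻ p, ∫⁻ z, ∫⁻ y, F (p.1, M.extend p.2 z y) ∂(M.rewardLaw z.1 (p.1 (M.bestAction z.1 z.2)))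
          ∂((ctx t p.2).prod (M.sampleLaw p.2)) ∂(M.runLaw ctx t) := by
  have := fun h : History d K t => hM.isProbabilityMeasure_sampleLaw h
  have h1 := hM.measurable_step_sample (K := K) t
  have h2 : Measurable fun p : Params d K × History d K t => (ctx t p.2).bind fun x =>
        (M.sampleLaw p.2).bind fun θ' =>
          (M.rewardLaw x (p.1 (M.bestAction x θ'))).map fun y =>
            (p.1, (Fin.snoc p.2 (x, M.bestAction x θ', y) : History d K (t + 1))) :=
    measurable_bind_prod ((ctx t).measurable.fun_comp measurable_snd) h1
  rw [runLaw, Measure.lintegral_bind h2.aemeasurable hF.aemeasurable]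
  refine lintegral_congr fun p => ?_
  have h3 := measurable_map_rewardLaw (M := M) (K := K) t
  have h4 : ∀ z : Vec d × Params d K, Measurable fun y => (p.1, M.extend p.2 z y) := fun z =>
    measurable_const.prodMk (measurable_extend measurable_const measurable_const measurable_id)
  have h5 : Measurable fun z : Vec d × Params d K =>
      (M.rewardLaw z.1 (p.1 (M.bestAction z.1 z.2))).map fun y => (p.1, M.extend p.2 z y) :=
    h3.comp (f := fun z : Vec d × Params d K => ((p, z.1), z.2))
      ((measurable_const.prodMk measurable_fst).prodMk measurable_snd)
  have h6 : Measurable fun z : Vec d × Params d K =>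
      ∫⁻ y, F (p.1, M.extend p.2 z y) ∂(M.rewardLaw z.1 (p.1 (M.bestAction z.1 z.2))) := by
    have e : ∀ z : Vec d × Params d K,
        ∫⁻ y, F (p.1, M.extend p.2 z y) ∂(M.rewardLaw z.1 (p.1 (M.bestAction z.1 z.2)))
          = ∫⁻ q, F q ∂((M.rewardLaw z.1 (p.1 (M.bestAction z.1 z.2))).map
              fun y => (p.1, M.extend p.2 z y)) := fun z => (lintegral_map hF (h4 z)).symm
    simp_rw [e]
    exact (Measure.measurable_lintegral hF).comp h5
  rw [Measure.lintegral_bind (h1.fun_comp (measurable_prodMk_left (x := p))).aemeasurable hF.aemeasurable,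
    lintegral_prod _ h6.aemeasurable]
  refine lintegral_congr fun x => ?_
  have h7 := (h5.fun_comp (measurable_prodMk_left (x := x))).aemeasurable (μ := M.sampleLaw p.2)
  refine (Measure.lintegral_bind h7 hF.aemeasurable).trans ?_
  exact lintegral_congr fun θ' => lintegral_map hF (h4 (x, θ'))

/-- The one-step Bayes formula: once the context and the action are fixed, updating the posterior
by the reward and drawing a fresh parameter from it leaves the joint law unchanged. -/
theorem Regular.lintegral_sampleLaw_rewardLaw [NeZero K] (hM : M.Regular) {t : ℕ}
    (h : History d K t) (z : Vec d × Params d K)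
    {F : Params d K × History d K (t + 1) → ℝ≥0∞} (hF : Measurable F) :
    ∫⁻ θ, ∫⁻ y, F (θ, M.extend h z y) ∂(M.rewardLaw z.1 (θ (M.bestAction z.1 z.2)))
        ∂(M.sampleLaw h)
      = ∫⁻ θ, ∫⁻ y, ∫⁻ θ', F (θ', M.extend h z y) ∂(M.sampleLaw (M.extend h z y))
          ∂(M.rewardLaw z.1 (θ (M.bestAction z.1 z.2))) ∂(M.sampleLaw h) := by
  have hp := isProbabilityMeasure_prior (K := K) hM.1 hM.3
  have hs := fun h : History d K (t + 1) => hM.isProbabilityMeasure_sampleLaw h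
  have hme : Measurable fun y => M.extend h z y :=
    measurable_extend measurable_const measurable_const measurable_id
  have key : ∀ G : Params d K × ℝ → ℝ≥0∞, Measurable G →
      ∫⁻ θ, ∫⁻ y, G (θ, y) ∂(M.rewardLaw z.1 (θ (M.bestAction z.1 z.2))) ∂(M.sampleLaw h)
        = (∫⁻ θ, M.lik h θ ∂(M.prior K))⁻¹
          * ∫⁻ y, ∫⁻ θ, M.lik (M.extend h z y) θ * G (θ, y) ∂(M.prior K) := by
    intro G hG
    have hpdf : Measurable fun q : Params d K × ℝ =>
        M.rewardPDF z.1 (q.1 (M.bestAction z.1 z.2)) q.2 :=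
      M.measurable_rewardPDF measurable_const
        ((measurable_pi_apply _).comp measurable_fst) measurable_snd
    simp_rw [fun θ : Params d K => lintegral_rewardLaw hM.2 z.1 (θ (M.bestAction z.1 z.2))
      (F := fun y => G (θ, y)) (hG.comp measurable_prodMk_left)]
    rw [lintegral_sampleLaw hM.1 hM.2 hM.3 h (hpdf.fun_mul hG).lintegral_prod_right']
    congr 1
    have hl := M.measurable_lik_right h
    rw [lintegral_lintegral_swap]
    · refine lintegral_congr fun θ => ?_
      rw [← lintegral_const_mul _ ((hpdf.fun_mul hG).fun_comp measurable_prodMk_left)]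
      refine lintegral_congr fun y => ?_
      simp only [extend, lik_snoc]
      ring
    · exact ((M.measurable_lik_comp (hme.comp measurable_fst) measurable_snd).fun_mul
        (hG.comp measurable_swap)).aemeasurable
  rw [key (fun q => F (q.1, M.extend h z q.2))
      (hF.comp (measurable_fst.prodMk (hme.comp measurable_snd))),
    key (fun q => ∫⁻ θ', F (θ', M.extend h z q.2) ∂(M.sampleLaw (M.extend h z q.2)))]
  · congr 1
    refine lintegral_congr fun y => ?_
    simp only
    rw [lintegral_mul_const _ (M.measurable_lik_right _),
      lintegral_sampleLaw hM.1 hM.2 hM.3 _ (hF.fun_comp measurable_prodMk_right), ← mul_assoc,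
      ENNReal.mul_inv_cancel (lintegral_lik_ne_zero hM.2 _ _) (lintegral_lik_ne_top _ _), one_mul]
  · let k : Kernel (History d K (t + 1)) (Params d K) := ⟨_, hM.measurable_sampleLaw⟩
    have : IsMarkovKernel k := ⟨hs⟩
    have hk : Measurable fun h' : History d K (t + 1) => ∫⁻ θ', F (θ', h') ∂(k h') :=
      Measurable.lintegral_kernel_prod_right (f := fun h' θ' => F (θ', h'))
        (hF.comp measurable_swap)
    exact hk.comp (hme.comp measurable_snd)

theorem Regular.measurable_lintegral_sampleLaw (hM : M.Regular) {t : ℕ}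
    {F : Params d K × History d K t → ℝ≥0∞} (hF : Measurable F) :
    Measurable fun h : History d K t => ∫⁻ θ, F (θ, h) ∂(M.sampleLaw h) := by
  let k : Kernel (History d K t) (Params d K) := ⟨_, hM.measurable_sampleLaw⟩
  have : IsMarkovKernel k := ⟨fun h => hM.isProbabilityMeasure_sampleLaw h⟩
  exact Measurable.lintegral_kernel_prod_right (κ := k) (f := fun h' θ' => F (θ', h'))
        (hF.comp measurable_swap)

/-- Given the history, the true parameters and freshly sampled ones have the same law: the sampling
law is the conditional law of the parameters given the history. -/
theorem Regular.lintegral_runLaw_eq_sampleLaw [NeZero K] (hM : M.Regular)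
    (ctx : (t : ℕ) → Kernel (History d K t) (Vec d)) [∀ t, IsMarkovKernel (ctx t)] (t : ℕ)
    {F : Params d K × History d K t → ℝ≥0∞} (hF : Measurable F) :
    ∫⁻ p, F p ∂(M.runLaw ctx t)
      = ∫⁻ p, ∫⁻ θ, F (θ, p.2) ∂(M.sampleLaw p.2) ∂(M.runLaw ctx t) := by
  have hp := isProbabilityMeasure_prior (K := K) hM.1 hM.3
  induction t with
  | zero =>
    have hs : ∀ h : History d K 0, M.sampleLaw h = M.prior K := fun h => by
      rw [sampleLaw_eq hM.1 hM.2 hM.3]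
      have : M.lik h = 1 := funext fun θ => by simp [lik]
      simp [this, withDensity_one]
    have hm : Measurable fun θ : Params d K => (θ, (Fin.elim0 : History d K 0)) :=
      measurable_id.prodMk measurable_const
    have hF' : Measurable fun θ : Params d K => F (θ, Fin.elim0) := hF.comp hm
    have e : ∀ p : Params d K × History d K 0, ∫⁻ θ, F (θ, p.2) ∂(M.sampleLaw p.2)
        = ∫⁻ θ, F (θ, Fin.elim0) ∂(M.prior K) := fun p => by
      rw [hs, Subsingleton.elim p.2 Fin.elim0]
    simp_rw [e, runLaw]
    rw [lintegral_map hF hm, lintegral_map measurable_const hm]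
    simp
  | succ t ih =>
    have hs := fun h : History d K t => hM.isProbabilityMeasure_sampleLaw h
    have hG := hM.measurable_lintegral_sampleLaw hF
    -- integrating out the new round leaves a measurable function of the past
    have hm : ∀ {G : Params d K × History d K (t + 1) → ℝ≥0∞}, Measurable G →
        Measurable fun q : (Params d K × History d K t) × (Vec d × Params d K) =>
          ∫⁻ y, G (q.1.1, M.extend q.1.2 q.2 y)
            ∂(M.rewardLaw q.2.1 (q.1.1 (M.bestAction q.2.1 q.2.2))) := by
      intro G hG
      let k : Kernel ((Params d K × History d K t) × (Vec d × Params d K)) ℝ :=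
        ⟨_, measurable_rewardLaw (M := M) measurable_snd.fst (measurable_eval_params
          measurable_fst.fst (measurable_bestAction (M := M).comp measurable_snd))⟩
      have : IsMarkovKernel k := ⟨fun q => by
        change IsProbabilityMeasure (M.rewardLaw _ _); infer_instance⟩
      exact Measurable.lintegral_kernel_prod_right (κ := k)
        (f := fun q y => G (q.1.1, M.extend q.1.2 q.2 y))
        (hG.comp (measurable_fst.fst.fst.prodMk
          (measurable_extend measurable_fst.fst.snd measurable_fst.snd measurable_snd)))
    have hm' : ∀ {G : Params d K × History d K (t + 1) → ℝ≥0∞}, Measurable G →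
        Measurable fun p : Params d K × History d K t => ∫⁻ z, ∫⁻ y, G (p.1, M.extend p.2 z y)
          ∂(M.rewardLaw z.1 (p.1 (M.bestAction z.1 z.2)))
          ∂((ctx t p.2).prod (M.sampleLaw p.2)) := by
      intro G hG
      let k : Kernel (Params d K × History d K t) (Vec d × Params d K) :=
        ((ctx t) ×ₖ ⟨_, hM.measurable_sampleLaw⟩).comap Prod.snd measurable_snd
      have : IsMarkovKernel
          (⟨_, hM.measurable_sampleLaw⟩ : Kernel (History d K t) (Params d K)) := ⟨hs⟩
      have hk : ∀ p, k p = (ctx t p.2).prod (M.sampleLaw p.2) := fun p => by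
        rw [Kernel.comap_apply, Kernel.prod_apply]; rfl
      have : IsMarkovKernel k := ⟨fun q => by rw [hk]; infer_instance⟩
      simp_rw [← hk]
      exact Measurable.lintegral_kernel_prod_right (κ := k) (hm hG)
    rw [hM.lintegral_runLaw_succ ctx t hF, hM.lintegral_runLaw_succ ctx t (hG.fun_comp measurable_snd),
      ih (hm' hF), ih (hm' (hG.fun_comp measurable_snd))]
    refine lintegral_congr fun p => ?_
    have hswap : ∀ {G : Params d K × History d K (t + 1) → ℝ≥0∞}, Measurable G →
        ∫⁻ θ, ∫⁻ z, ∫⁻ y, G (θ, M.extend p.2 z y)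
          ∂(M.rewardLaw z.1 (θ (M.bestAction z.1 z.2)))
          ∂((ctx t p.2).prod (M.sampleLaw p.2)) ∂(M.sampleLaw p.2)
        = ∫⁻ z, ∫⁻ θ, ∫⁻ y, G (θ, M.extend p.2 z y)
          ∂(M.rewardLaw z.1 (θ (M.bestAction z.1 z.2)))
          ∂(M.sampleLaw p.2) ∂((ctx t p.2).prod (M.sampleLaw p.2)) := by
      intro G hG
      refine lintegral_lintegral_swap (Measurable.aemeasurable ?_)
      exact (hm hG).comp (f := fun q : Params d K × (Vec d × Params d K) => ((q.1, p.2), q.2))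
        ((measurable_fst.prodMk measurable_const).prodMk measurable_snd)
    simp only
    rw [hswap hF, hswap (hG.fun_comp measurable_snd)]
    exact lintegral_congr fun z => hM.lintegral_sampleLaw_rewardLaw p.2 z hF

end Model

/-! ### The prior is a linear image of white noise -/

/-- The law of standard Gaussian white noise indexed by `ι`. -/
noncomputable abbrev whiteNoise (ι : Type*) [Fintype ι] : Measure (ι → ℝ) :=
  Measure.pi fun _ => gaussianReal 0 1

theorem norm_toEuclideanCLM_le {d : ℕ} {W : Matrix (Fin d) (Fin d) ℝ}
    (hW : ∀ r, Module.End.HasEigenvalue (Matrix.toLin' (W.transpose * W)) r → r ≤ 1) (ψ : Vec d) :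
    ‖Matrix.toEuclideanCLM (𝕜 := ℝ) W ψ‖ ≤ ‖ψ‖ := by
  have hA : (1 - W.transpose * W).IsHermitian := by
    refine Matrix.isHermitian_one.sub ?_
    simpa using Matrix.isHermitian_conjTranspose_mul_self W
  have hpos : (1 - W.transpose * W).PosSemidef := by
    refine hA.posSemidef_iff_eigenvalues_nonneg.2 fun i => ?_
    have h1 := hA.mulVec_eigenvectorBasis i
    have h2 : (hA.eigenvectorBasis i).ofLp ≠ 0 := fun h =>
      hA.eigenvectorBasis.toBasis.ne_zero i (by simpa using h)
    rw [Matrix.sub_mulVec, Matrix.one_mulVec, sub_eq_iff_eq_add] at h1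
    have h3 := hW (1 - hA.eigenvalues i) (Module.End.hasEigenvalue_of_hasEigenvector
      (x := (hA.eigenvectorBasis i).ofLp) ⟨Module.End.mem_eigenspace_iff.2 (by
        rw [Matrix.toLin'_apply, sub_smul, one_smul]
        exact eq_sub_of_add_eq' h1.symm), h2⟩)
    simpa using h3
  have h := hpos.dotProduct_mulVec_nonneg ψ.ofLp
  rw [Matrix.sub_mulVec, Matrix.one_mulVec, dotProduct_sub, ← Matrix.mulVec_mulVec,
    Matrix.dotProduct_mulVec, sub_nonneg] at h
  refine le_of_sq_le_sq ?_ (norm_nonneg _)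
  rw [EuclideanSpace.real_norm_sq_eq, EuclideanSpace.real_norm_sq_eq]
  simpa [dotProduct, sq, Matrix.vecMul_transpose] using h

open scoped MatrixOrder in
theorem multivariateGaussian_smul_one {d : ℕ} (m : Vec d) {s : ℝ} (hs : 0 ≤ s) :
    multivariateGaussian m (s ^ 2 • (1 : Matrix (Fin d) (Fin d) ℝ))
      = (whiteNoise (Fin d)).map fun z => m + s • WithLp.toLp 2 z := by
  have h0 : (0 : Matrix (Fin d) (Fin d) ℝ) ≤ s • 1 := (Matrix.PosSemidef.one.smul hs).nonneg
  have h1 : CFC.sqrt (s ^ 2 • (1 : Matrix (Fin d) (Fin d) ℝ)) = s • 1 := by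
    rw [show s ^ 2 • (1 : Matrix (Fin d) (Fin d) ℝ) = (s • 1) * (s • 1) by
      rw [smul_mul_smul_comm, one_mul, sq]]
    exact CFC.sqrt_mul_self _ h0
  rw [multivariateGaussian, h1, ← map_pi_eq_stdGaussian, Measure.map_map (by fun_prop) (by fun_prop)]
  congr 1
  funext z
  simp

theorem map_curry_whiteNoise (ι κ : Type*) [Fintype ι] [Fintype κ] :
    (whiteNoise (ι × κ)).map Function.curry = Measure.pi fun _ : ι => whiteNoise κ := by
  have h := Measure.infinitePi_map_curry fun (_ : ι) (_ : κ) => gaussianReal 0 1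
  rw [Measure.infinitePi_eq_pi, Measure.infinitePi_eq_pi] at h
  simp_rw [Measure.infinitePi_eq_pi] at h
  exact h

theorem measurable_linearMap_pi {ι E : Type*} [Fintype ι] [NormedAddCommGroup E] [NormedSpace ℝ E]
    [MeasurableSpace E] [BorelSpace E] (T : (ι → ℝ) →ₗ[ℝ] E) : Measurable T :=
  (LinearMap.continuous_of_finiteDimensional T).measurable

instance {d K : ℕ} : BorelSpace (Params d K) := inferInstanceAs (BorelSpace (Fin K → Vec d))

/-- A two-stage draw driven by independent white noises is a function of white noise on the
disjoint union of the index sets. -/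
theorem bind_map_whiteNoise {ι κ α β : Type*} [Fintype ι] [Fintype κ] [MeasurableSpace α]
    [MeasurableSpace β] {f : (ι → ℝ) → α} (hf : Measurable f) {g : α → (κ → ℝ) → β}
    (hg : Measurable (Function.uncurry g)) :
    ((whiteNoise ι).map f).bind (fun a => (whiteNoise κ).map (g a))
      = (whiteNoise (ι ⊕ κ)).map fun z => g (f (z ∘ Sum.inl)) (z ∘ Sum.inr) := by
  have hm : Measurable fun a => (whiteNoise κ).map (g a) :=
    measurable_map_prod (κ := fun _ => whiteNoise κ) measurable_const hg
  have hu : Measurable fun q : (ι → ℝ) × (κ → ℝ) => g (f q.1) q.2 :=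
    hg.comp ((hf.comp measurable_fst).prodMk measurable_snd)
  have h := (measurePreserving_sumPiEquivProdPi fun _ : ι ⊕ κ => gaussianReal 0 1).map_eq
  have e : (fun z : ι ⊕ κ → ℝ => g (f (z ∘ Sum.inl)) (z ∘ Sum.inr))
      = (fun q : (ι → ℝ) × (κ → ℝ) => g (f q.1) q.2)
        ∘ MeasurableEquiv.sumPiEquivProdPi (fun _ : ι ⊕ κ => ℝ) := rfl
  rw [e, ← Measure.map_map hu (MeasurableEquiv.measurable _), h]
  ext s hs
  rw [Measure.bind_apply hs hm.aemeasurable,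
    lintegral_map ((Measure.measurable_coe hs).fun_comp hm) hf, Measure.map_apply hu hs,
    Measure.prod_apply (hu hs)]
  refine lintegral_congr fun u => ?_
  have hgu : Measurable (g (f u)) := hg.comp measurable_prodMk_left
  rw [Measure.map_apply hgu hs]
  rfl

theorem sum_inner_sq_le {d : ℕ} (A : Vec d →ₗ[ℝ] Vec d) (hA : ∀ ψ, ‖A ψ‖ ≤ ‖ψ‖) (x : Vec d)
    (hx : ‖x‖ = 1) :
    ∑ i, (⟪x, A (WithLp.toLp 2 (Pi.single i 1))⟫ : ℝ) ^ 2 ≤ 1 := by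
  set u : Vec d := WithLp.toLp 2 fun i => (⟪x, A (WithLp.toLp 2 (Pi.single i 1))⟫ : ℝ) with hu
  have h1 : ∑ i, (⟪x, A (WithLp.toLp 2 (Pi.single i 1))⟫ : ℝ) ^ 2 = ‖u‖ ^ 2 := by
    rw [EuclideanSpace.real_norm_sq_eq]
  have h2 : u = ∑ i, u i • WithLp.toLp 2 (Pi.single i (1 : ℝ)) := by
    ext j
    simp [Finset.sum_apply, Pi.single_apply]
  have h3 : ‖u‖ ^ 2 = ⟪x, A u⟫ := by
    rw [← h1]
    conv_rhs => rw [h2]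
    rw [map_sum, inner_sum]
    refine Finset.sum_congr rfl fun i _ => ?_
    rw [map_smul, inner_smul_right, sq]
  have h4 : ‖u‖ ^ 2 ≤ ‖u‖ := by
    rw [h3]
    refine (real_inner_le_norm _ _).trans ?_
    rw [hx, one_mul]
    exact hA u
  rw [h1]
  nlinarith [norm_nonneg u]

theorem sum_inner_smul_sq_le {d : ℕ} (A : Vec d →ₗ[ℝ] Vec d) (hA : ∀ ψ, ‖A ψ‖ ≤ ‖ψ‖) (x : Vec d)
    (hx : ‖x‖ = 1) (c : ℝ) :
    ∑ i, (⟪x, A (c • WithLp.toLp 2 (Pi.single i 1))⟫ : ℝ) ^ 2 ≤ c ^ 2 := by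
  simp_rw [map_smul, inner_smul_right, mul_pow]
  rw [← Finset.mul_sum]
  exact mul_le_of_le_one_right (sq_nonneg c) (sum_inner_sq_le A hA x hx)

/-- `IsNoiseImage μ N v A`: for every `ψ`, the measure `μ ψ` is the law of `A ψ + T z`, where `A`
and `T` are linear and `z` is white noise with `N` coordinates. Moreover no component of `A`
increases norms, and `xᵀ (T z)_a` has variance at most `v` for every unit vector `x`. -/
def IsNoiseImage {d K : ℕ} (μ : Vec d → Measure (Params d K)) (N : ℕ) (v : ℝ) : Prop :=
  ∃ (ι : Type) (_ : Fintype ι) (_ : DecidableEq ι) (A : Vec d →ₗ[ℝ] Params d K)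
    (T : (ι → ℝ) →ₗ[ℝ] Params d K), Fintype.card ι = N ∧
    (∀ ψ, μ ψ = (whiteNoise ι).map fun z => A ψ + T z) ∧ (∀ ψ a, ‖A ψ a‖ ≤ ‖ψ‖) ∧
    ∀ x a, ‖x‖ = 1 → ∑ i, (⟪x, T (Pi.single i 1) a⟫ : ℝ) ^ 2 ≤ v

theorem isNoiseImage_pi {d : ℕ} (K : ℕ) (V : Vec d →ₗ[ℝ] Vec d) (hV : ∀ ψ, ‖V ψ‖ ≤ ‖ψ‖) {s : ℝ}
    (hs : 0 ≤ s) :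
    IsNoiseImage (fun ψ => Measure.pi fun _ : Fin K =>
      multivariateGaussian (V ψ) (s ^ 2 • (1 : Matrix (Fin d) (Fin d) ℝ))) (d * K) (s ^ 2) := by
  let lp : (Fin d → ℝ) →ₗ[ℝ] Vec d := (WithLp.linearEquiv 2 ℝ (Fin d → ℝ)).symm.toLinearMap
  refine ⟨Fin K × Fin d, inferInstance, inferInstance, LinearMap.pi fun _ => V,
    LinearMap.pi fun a => s • (lp ∘ₗ LinearMap.funLeft ℝ ℝ fun j => (a, j)), by simp [mul_comm],
    fun ψ => ?_, fun ψ a => hV ψ, fun x a hx => ?_⟩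
  · simp_rw [multivariateGaussian_smul_one _ hs]
    have hm : Measurable fun z : Fin d → ℝ => V ψ + s • WithLp.toLp 2 z := by fun_prop
    have hp : IsProbabilityMeasure
        ((whiteNoise (Fin d)).map fun z => V ψ + s • WithLp.toLp 2 z) :=
      Measure.isProbabilityMeasure_map hm.aemeasurable
    rw [← Measure.pi_map_pi fun _ => hm.aemeasurable, ← map_curry_whiteNoise,
      Measure.map_map]
    · rfl
    · exact measurable_pi_lambda _ fun a => hm.comp (measurable_pi_apply a)
    · exact measurable_pi_lambda _ fun a => measurable_pi_lambda _ fun j => measurable_pi_apply _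
  · rw [Fintype.sum_prod_type, Finset.sum_eq_single a]
    · refine le_trans (le_of_eq ?_) (sum_inner_smul_sq_le LinearMap.id (fun _ => le_rfl) x hx s)
      refine Finset.sum_congr rfl fun j _ => ?_
      congr 3
      ext k
      simp [lp, LinearMap.funLeft_apply, Pi.single_apply]
    · intro b _ hb
      refine Finset.sum_eq_zero fun j _ => ?_
      have : (LinearMap.pi fun a => s • (lp ∘ₗ LinearMap.funLeft ℝ ℝ fun j => (a, j)))
          (Pi.single (b, j) 1) a = 0 := by
        ext k
        simp [lp, LinearMap.funLeft_apply, hb.symm]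
      simp [this]
    · simp

theorem IsNoiseImage.bind {d K N : ℕ} {v : ℝ} {μ : Vec d → Measure (Params d K)}
    (h : IsNoiseImage μ N v) (V : Vec d →ₗ[ℝ] Vec d) (hV : ∀ ψ, ‖V ψ‖ ≤ ‖ψ‖) {s : ℝ}
    (hs : 0 ≤ s) :
    IsNoiseImage (fun ψ =>
      (multivariateGaussian (V ψ) (s ^ 2 • (1 : Matrix (Fin d) (Fin d) ℝ))).bind μ)
      (d + N) (v + s ^ 2) := by
  obtain ⟨ι, _, _, A, T, hι, hμ, hA, hT⟩ := h
  let lp : (Fin d → ℝ) →ₗ[ℝ] Vec d := (WithLp.linearEquiv 2 ℝ (Fin d → ℝ)).symm.toLinearMap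
  refine ⟨Fin d ⊕ ι, inferInstance, inferInstance, A ∘ₗ V,
    s • (A ∘ₗ lp ∘ₗ LinearMap.funLeft ℝ ℝ Sum.inl) + T ∘ₗ LinearMap.funLeft ℝ ℝ Sum.inr,
    by simp [hι], fun ψ => ?_, fun ψ a => (hA _ a).trans (hV ψ), fun x a hx => ?_⟩
  · have hAm : Measurable A := (LinearMap.continuous_of_finiteDimensional A).measurable
    beta_reduce
    rw [multivariateGaussian_smul_one _ hs, show μ = _ from funext hμ,
      bind_map_whiteNoise (by fun_prop)
        ((hAm.comp measurable_fst).add ((measurable_linearMap_pi T).comp measurable_snd))]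
    congr 1
    funext z
    simp only [map_add, map_smul, LinearMap.add_apply, LinearMap.smul_apply, LinearMap.comp_apply,
      add_assoc]
    rfl
  · rw [Fintype.sum_sum_type, add_comm]
    refine add_le_add ?_ ?_
    · refine le_trans (le_of_eq ?_) (hT x a hx)
      refine Finset.sum_congr rfl fun i _ => ?_
      have h1 : LinearMap.funLeft ℝ ℝ (Sum.inl : Fin d → Fin d ⊕ ι) (Pi.single (Sum.inr i) 1) = 0 := by
        ext k; simp [LinearMap.funLeft_apply]
      have h2 : LinearMap.funLeft ℝ ℝ (Sum.inr : ι → Fin d ⊕ ι) (Pi.single (Sum.inr i) 1)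
          = Pi.single i 1 := by
        ext k; simp [LinearMap.funLeft_apply, Pi.single_apply]
      simp [h1, h2]
    · let A' : Vec d →ₗ[ℝ] Vec d :=
        LinearMap.proj (R := ℝ) (φ := fun _ : Fin K => Vec d) a ∘ₗ A
      refine le_trans (le_of_eq ?_) (sum_inner_smul_sq_le A' (fun ψ => hA ψ a) x hx s)
      refine Finset.sum_congr rfl fun i _ => ?_
      have h1 : LinearMap.funLeft ℝ ℝ (Sum.inl : Fin d → Fin d ⊕ ι) (Pi.single (Sum.inl i) 1)
          = Pi.single i 1 := by
        ext k; simp [LinearMap.funLeft_apply, Pi.single_apply]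
      have h2 : LinearMap.funLeft ℝ ℝ (Sum.inr : ι → Fin d ⊕ ι) (Pi.single (Sum.inl i) 1) = 0 := by
        ext k; simp [LinearMap.funLeft_apply]
      simp [h1, h2, lp, A']

theorem isNoiseImage_descend {d : ℕ} (K : ℕ) {L : ℕ} {W : ℕ → Matrix (Fin d) (Fin d) ℝ}
    {s : ℕ → ℝ} (σ : ℝ) (hs : ∀ ℓ ∈ Finset.Icc 1 (L + 1), 0 < s ℓ) (hW : UnitMixing L W) (ℓ : ℕ)
    (hℓ : ℓ + 1 ≤ L) :
    IsNoiseImage (descend (K := K) (linearModel L W s σ).layer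
      (fun _ => (linearModel L W s σ).layer 1) (ℓ + 1)) (d * (K + ℓ))
      (∑ j ∈ Finset.Icc 1 (ℓ + 1), s j ^ 2) := by
  have hV : ∀ j, 1 ≤ j → j ≤ L → ∀ ψ, ‖Matrix.toEuclideanCLM (𝕜 := ℝ) (W j) ψ‖ ≤ ‖ψ‖ :=
    fun j h1 h2 => norm_toEuclideanCLM_le fun r hr => (hW j (Finset.mem_Icc.2 ⟨h1, h2⟩)).2 hr
  induction ℓ with
  | zero =>
    have h := isNoiseImage_pi K (Matrix.toEuclideanCLM (𝕜 := ℝ) (W 1)).toLinearMap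
      (hV 1 le_rfl hℓ) (hs 1 (by simp)).le
    simpa [descend, Model.layer, linearModel, funext_iff] using h
  | succ ℓ ih =>
    have h := (ih (by omega)).bind (Matrix.toEuclideanCLM (𝕜 := ℝ) (W (ℓ + 2))).toLinearMap
      (hV (ℓ + 2) (by omega) (by omega))
      (hs (ℓ + 2) (Finset.mem_Icc.2 ⟨by omega, by omega⟩)).le
    rw [Finset.sum_Icc_succ_top (by omega)]
    rw [show d * (K + (ℓ + 1)) = d + d * (K + ℓ) by ring]
    exact h

/-- The prior is a linear image of white noise with `d * (K + L)` coordinates, and the variance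
of every `xᵀ θ_a` with `‖x‖ = 1` is at most `∑_ℓ σ_ℓ²`. -/
theorem exists_prior_eq_map {d : ℕ} (K : ℕ) {L : ℕ} (hL : 1 ≤ L)
    {W : ℕ → Matrix (Fin d) (Fin d) ℝ} {s : ℕ → ℝ} (σ : ℝ)
    (hs : ∀ ℓ ∈ Finset.Icc 1 (L + 1), 0 < s ℓ) (hW : UnitMixing L W) :
    ∃ (ι : Type) (_ : Fintype ι) (_ : DecidableEq ι) (T : (ι → ℝ) →ₗ[ℝ] Params d K),
      Fintype.card ι = d * (K + L) ∧
      (linearModel L W s σ).prior K = (whiteNoise ι).map T ∧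
      ∀ x a, ‖x‖ = 1 → ∑ i, (⟪x, T (Pi.single i 1) a⟫ : ℝ) ^ 2
        ≤ ∑ j ∈ Finset.Icc 1 (L + 1), s j ^ 2 := by
  obtain ⟨ℓ, rfl⟩ := Nat.exists_eq_add_of_le' hL
  obtain ⟨ι, i1, i2, A, T, hι, hμ, -, hT⟩ := (isNoiseImage_descend K σ hs hW ℓ le_rfl).bind
    0 (by simp) (hs (ℓ + 1 + 1) (by simp)).le
  refine ⟨ι, i1, i2, T, ?_, ?_, ?_⟩
  · rw [hι]; ring
  · have := hμ 0
    simpa [Model.prior, Model.top, linearModel] using this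
  · rwa [Finset.sum_Icc_succ_top (by omega)]

/-! ### Gaussian posteriors -/

theorem whiteNoise_eq_withDensity (ι : Type*) [Fintype ι] :
    whiteNoise ι = volume.withDensity fun z => ∏ i, gaussianPDF 0 1 (z i) := by
  refine Measure.pi_eq fun s hs => ?_
  rw [withDensity_apply _ (MeasurableSet.univ_pi hs), volume_pi,
    setLIntegral_prod_pi fun _ => measurable_gaussianPDF 0 1]
  refine Finset.prod_congr rfl fun i _ => ?_
  rw [gaussianReal_apply _ one_ne_zero]

section Tilt

variable {ι : Type*} [Fintype ι]

theorem dotProduct_mulVec_comm {P : Matrix ι ι ℝ} (hP : P.IsHermitian) (u v : ι → ℝ) :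
    u ⬝ᵥ P.mulVec v = v ⬝ᵥ P.mulVec u := by
  have h : P.transpose = P := by simpa using hP.eq
  rw [Matrix.dotProduct_mulVec, ← Matrix.mulVec_transpose, h, dotProduct_comm]

/-- The moment generating function of the Gaussian density `exp (-zᵀPz/2 + bᵀz)`, centred at
`P⁻¹b`: completing the square and translation invariance of Lebesgue measure. -/
theorem lintegral_exp_mul_gaussian [DecidableEq ι] {P : Matrix ι ι ℝ} (hP : P.PosDef) (b u : ι → ℝ) :
    ∫⁻ z : ι → ℝ, ENNReal.ofReal (Real.exp (-(z ⬝ᵥ P.mulVec z) / 2 + b ⬝ᵥ z))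
        * ENNReal.ofReal (Real.exp (u ⬝ᵥ z - u ⬝ᵥ P⁻¹.mulVec b))
      = (∫⁻ z : ι → ℝ, ENNReal.ofReal (Real.exp (-(z ⬝ᵥ P.mulVec z) / 2 + b ⬝ᵥ z)))
        * ENNReal.ofReal (Real.exp (u ⬝ᵥ P⁻¹.mulVec u / 2)) := by
  have hdet : IsUnit P.det := (Matrix.isUnit_iff_isUnit_det P).1 hP.isUnit
  have hPe : P.mulVec (P⁻¹.mulVec u) = u := by
    rw [Matrix.mulVec_mulVec, Matrix.mul_nonsing_inv _ hdet, Matrix.one_mulVec]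
  set e := P⁻¹.mulVec u with he
  have hb : u ⬝ᵥ P⁻¹.mulVec b = b ⬝ᵥ e := dotProduct_mulVec_comm hP.isHermitian.inv u b
  rw [← lintegral_add_right_eq_self _ e, ← lintegral_mul_const' _ _ ENNReal.ofReal_ne_top]
  refine lintegral_congr fun z => ?_
  rw [← ENNReal.ofReal_mul (Real.exp_pos _).le, ← ENNReal.ofReal_mul (Real.exp_pos _).le,
    ← Real.exp_add, ← Real.exp_add, hb]
  congr 2
  have h1 : e ⬝ᵥ P.mulVec z = z ⬝ᵥ u := by
    rw [dotProduct_mulVec_comm hP.isHermitian, hPe]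
  rw [Matrix.mulVec_add, hPe, dotProduct_add, add_dotProduct, add_dotProduct, h1, dotProduct_add,
    dotProduct_add, dotProduct_comm u z, dotProduct_comm u e]
  ring

end Tilt

/-- A sub-Gaussian random variable is centred. -/
theorem integral_eq_zero_of_hasSubgaussianMGF {Ω : Type*} [MeasurableSpace Ω] {μ : Measure Ω}
    [IsProbabilityMeasure μ] {X : Ω → ℝ} {c : ℝ≥0} (h : HasSubgaussianMGF X c μ) :
    ∫ ω, X ω ∂μ = 0 := by
  have key : ∀ {Y : Ω → ℝ}, HasSubgaussianMGF Y c μ → ∫ ω, Y ω ∂μ ≤ 0 := by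
    intro Y hY
    have h1 : ∀ t : ℝ, 1 + t * ∫ ω, Y ω ∂μ ≤ Real.exp (c * t ^ 2 / 2) := by
      intro t
      have h2 : ∫ ω, (1 + t * Y ω) ∂μ ≤ ∫ ω, Real.exp (t * Y ω) ∂μ :=
        integral_mono ((integrable_const 1).add (hY.integrable.const_mul t))
          (hY.integrable_exp_mul t) fun ω => by
            simpa [add_comm] using Real.add_one_le_exp (t * Y ω)
      rw [integral_add (integrable_const 1) (hY.integrable.const_mul t), integral_const_mul] at h2
      simpa using h2.trans (hY.mgf_le t)
    -- the derivative at `0` of the right-hand side vanishes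
    by_contra! hpos
    set m := ∫ ω, Y ω ∂μ
    have h3 : HasDerivAt (fun t : ℝ => Real.exp (c * t ^ 2 / 2) - (1 + t * m)) (-m) 0 := by
      have := (((hasDerivAt_pow 2 (0 : ℝ)).const_mul (c : ℝ)).div_const 2).exp.fun_sub
        (((hasDerivAt_id (0 : ℝ)).mul_const m).const_add 1)
      simpa using this
    have h4 : IsLocalMin (fun t : ℝ => Real.exp (c * t ^ 2 / 2) - (1 + t * m)) 0 :=
      Filter.Eventually.of_forall fun t => by simpa using h1 t
    have := h4.hasDerivAt_eq_zero h3
    linarith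
  refine le_antisymm (key h) ?_
  have := key h.neg
  simp only [Pi.neg_apply, integral_neg] at this
  linarith

section Posterior

variable {ι : Type*} [Fintype ι] {d K : ℕ}

/-- The vector representing `xᵀ θ_a` as a linear function of the white noise, for `θ = T z`. -/
noncomputable def feature [DecidableEq ι] (T : (ι → ℝ) →ₗ[ℝ] Params d K) (x : Vec d)
    (a : Fin K) (i : ι) : ℝ := ⟪x, T (Pi.single i 1) a⟫

theorem inner_apply_eq_feature [DecidableEq ι] (T : (ι → ℝ) →ₗ[ℝ] Params d K) (x : Vec d)
    (a : Fin K) (z : ι → ℝ) : (⟪x, T z a⟫ : ℝ) = feature T x a ⬝ᵥ z := by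
  conv_lhs => rw [LinearMap.pi_apply_eq_sum_univ T z]
  rw [Finset.sum_apply, inner_sum]
  refine Finset.sum_congr rfl fun i _ => ?_
  rw [Pi.smul_apply, inner_smul_right, mul_comm, feature]
  have : (fun j => if i = j then (1 : ℝ) else 0) = Pi.single i 1 := by
    ext j
    simp [Pi.single_apply, eq_comm]
  rw [this]

/-- The precision matrix of white noise after noisy linear observations along `w 0, w 1, …`. -/
noncomputable def precision [DecidableEq ι] {t : ℕ} (v : ℝ) (w : Fin t → ι → ℝ) : Matrix ι ι ℝ :=
  1 + v⁻¹ • ∑ i, Matrix.vecMulVec (w i) (w i)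

theorem posDef_precision [DecidableEq ι] {t : ℕ} {v : ℝ} (hv : 0 ≤ v) (w : Fin t → ι → ℝ) :
    (precision v w).PosDef := by
  refine Matrix.PosDef.one.add_posSemidef (Matrix.PosSemidef.smul ?_ (inv_nonneg.2 hv))
  refine Matrix.posSemidef_sum _ fun i _ => ?_
  simpa using Matrix.posSemidef_vecMulVec_self_star (w i)

theorem dotProduct_precision_mulVec [DecidableEq ι] {t : ℕ} (v : ℝ) (w : Fin t → ι → ℝ)
    (z : ι → ℝ) :
    z ⬝ᵥ (precision v w).mulVec z = z ⬝ᵥ z + v⁻¹ * ∑ i, (w i ⬝ᵥ z) ^ 2 := by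
  rw [precision, Matrix.add_mulVec, Matrix.one_mulVec, dotProduct_add, Matrix.smul_mulVec,
    dotProduct_smul, smul_eq_mul, Matrix.sum_mulVec, dotProduct_sum]
  congr 2
  refine Finset.sum_congr rfl fun i _ => ?_
  rw [Matrix.vecMulVec_mulVec, dotProduct_smul, dotProduct_comm z]
  simp [sq]

/-- The density of the noise times the likelihood of linear observations is, up to a constant,
the Gaussian density with precision matrix `precision v w`. -/
theorem exists_prod_gaussianPDF_eq [DecidableEq ι] {t : ℕ} {v : ℝ≥0} (hv : v ≠ 0)
    (w : Fin t → ι → ℝ) (y : Fin t → ℝ) :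
    ∃ c : ℝ≥0∞, c ≠ 0 ∧ c ≠ ∞ ∧ ∃ b : ι → ℝ, ∀ z : ι → ℝ,
      (∏ i, gaussianPDF 0 1 (z i)) * ∏ i, gaussianPDF (w i ⬝ᵥ z) v (y i)
        = c * ENNReal.ofReal (Real.exp (-(z ⬝ᵥ (precision v w).mulVec z) / 2 + b ⬝ᵥ z)) := by
  have hv' : (0 : ℝ) < v := by positivity
  set c : ℝ := (∏ _i : ι, (√(2 * Real.pi * (1 : ℝ≥0)))⁻¹)
    * (∏ _i : Fin t, (√(2 * Real.pi * v))⁻¹) * Real.exp (-(v : ℝ)⁻¹ / 2 * ∑ i, y i ^ 2) with hc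
  have hc0 : 0 < c := by
    refine mul_pos (mul_pos ?_ ?_) (Real.exp_pos _) <;>
      exact Finset.prod_pos fun _ _ => by positivity
  refine ⟨ENNReal.ofReal c, by simpa using hc0, ENNReal.ofReal_ne_top,
    (v : ℝ)⁻¹ • ∑ i, y i • w i, fun z => ?_⟩
  simp only [gaussianPDF]
  rw [← ENNReal.ofReal_prod_of_nonneg fun _ _ => gaussianPDFReal_nonneg _ _ _,
    ← ENNReal.ofReal_prod_of_nonneg fun _ _ => gaussianPDFReal_nonneg _ _ _,
    ← ENNReal.ofReal_mul (Finset.prod_nonneg fun _ _ => gaussianPDFReal_nonneg _ _ _),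
    ← ENNReal.ofReal_mul hc0.le]
  congr 1
  simp only [gaussianPDFReal]
  rw [Finset.prod_mul_distrib, Finset.prod_mul_distrib, ← Real.exp_sum, ← Real.exp_sum, hc,
    mul_mul_mul_comm, ← Real.exp_add, mul_assoc _ (Real.exp _), ← Real.exp_add,
    dotProduct_precision_mulVec]
  congr 2
  rw [smul_dotProduct, sum_dotProduct, dotProduct, smul_eq_mul]
  have h1 : ∀ i, -(y i - w i ⬝ᵥ z) ^ 2 / (2 * (v : ℝ))
      = -(v : ℝ)⁻¹ / 2 * y i ^ 2 + (v : ℝ)⁻¹ * (y i * (w i ⬝ᵥ z)) - (v : ℝ)⁻¹ / 2 * (w i ⬝ᵥ z) ^ 2 :=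
    fun i => by field_simp; ring
  simp_rw [h1, smul_dotProduct, smul_eq_mul]
  rw [Finset.sum_sub_distrib, Finset.sum_add_distrib, ← Finset.mul_sum, ← Finset.mul_sum,
    ← Finset.mul_sum]
  have h2 : ∑ i, -(z i - 0) ^ 2 / (2 * ((1 : ℝ≥0) : ℝ)) = -(∑ i, z i * z i) / 2 := by
    rw [neg_div, Finset.sum_div, ← Finset.sum_neg_distrib]
    exact Finset.sum_congr rfl fun i _ => by simp; ring
  rw [h2]
  ring

/-- The posterior variance of `xᵀ θ_a` given the history `h`. -/
noncomputable def posteriorVar [DecidableEq ι] (T : (ι → ℝ) →ₗ[ℝ] Params d K) (v : ℝ) {t : ℕ}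
    (h : History d K t) (x : Vec d) (a : Fin K) : ℝ :=
  feature T x a ⬝ᵥ (precision v fun i => feature T (h i).1 (h i).2.1)⁻¹.mulVec (feature T x a)

theorem posteriorVar_nonneg [DecidableEq ι] (T : (ι → ℝ) →ₗ[ℝ] Params d K) {v : ℝ} (hv : 0 ≤ v)
    {t : ℕ} (h : History d K t) (x : Vec d) (a : Fin K) : 0 ≤ posteriorVar T v h x a := by
  have := (posDef_precision hv fun i => feature T (h i).1 (h i).2.1).inv.posSemidef
  simpa [posteriorVar] using this.dotProduct_mulVec_nonneg (feature T x a)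

/-- Under the sampling law, `xᵀ θ_a` is sub-Gaussian around some mean, with variance proxy the
posterior variance. -/
theorem exists_hasSubgaussianMGF_sampleLaw [DecidableEq ι] {M : Model d} (hM : M.Regular)
    {T : (ι → ℝ) →ₗ[ℝ] Params d K} (hT : M.prior K = (whiteNoise ι).map T) {t : ℕ}
    (h : History d K t) (x : Vec d) (a : Fin K) :
    ∃ m : ℝ, HasSubgaussianMGF (fun θ : Params d K => ⟪x, θ a⟫ - m)
      (posteriorVar T M.noiseVar h x a).toNNReal (M.sampleLaw h) := by
  obtain ⟨c, hc0, hc1, b, hb⟩ := exists_prod_gaussianPDF_eq hM.noiseVar_ne_zero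
    (fun i => feature T (h i).1 (h i).2.1) (fun i => (h i).2.2)
  set P := precision (M.noiseVar : ℝ) (fun i => feature T (h i).1 (h i).2.1) with hPdef
  have hP : P.PosDef := posDef_precision M.noiseVar.coe_nonneg _
  have hpr := Model.isProbabilityMeasure_prior (K := K) hM.1 hM.3
  have hps := hM.isProbabilityMeasure_sampleLaw h
  have hTm := measurable_linearMap_pi T
  -- integrals of the likelihood against the prior are integrals of a Gaussian density
  have hint : ∀ G : Params d K → ℝ≥0∞, Measurable G →
      ∫⁻ θ, M.lik h θ * G θ ∂(M.prior K) = c * ∫⁻ z : ι → ℝ,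
        ENNReal.ofReal (Real.exp (-(z ⬝ᵥ P.mulVec z) / 2 + b ⬝ᵥ z)) * G (T z) := by
    intro G hG
    have h1 := (M.measurable_lik_right h).fun_mul hG
    rw [hT, lintegral_map h1 hTm, whiteNoise_eq_withDensity,
      lintegral_withDensity_eq_lintegral_mul _ _ (h1.fun_comp hTm), ← lintegral_const_mul' _ _ hc1]
    · refine lintegral_congr fun z => ?_
      rw [← mul_assoc, ← hb z, Pi.mul_apply, ← mul_assoc]
      congr 2
      refine Finset.prod_congr rfl fun i _ => ?_
      rw [Model.rewardPDF, inner_apply_eq_feature]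
    · exact Finset.measurable_fun_prod _ fun i _ =>
        (measurable_gaussianPDF 0 1).comp (measurable_pi_apply i)
  set q := posteriorVar T M.noiseVar h x a with hq
  have hq0 : 0 ≤ q := posteriorVar_nonneg T M.noiseVar.coe_nonneg h x a
  set m := feature T x a ⬝ᵥ P⁻¹.mulVec b with hm
  have hmeas : Measurable fun θ : Params d K => (⟪x, θ a⟫ : ℝ) - m :=
    (measurable_const.inner (measurable_pi_apply a)).sub_const m
  have key : ∀ r : ℝ, ∫⁻ θ, ENNReal.ofReal (Real.exp (r * (⟪x, θ a⟫ - m))) ∂(M.sampleLaw h)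
      = ENNReal.ofReal (Real.exp (q * r ^ 2 / 2)) := by
    intro r
    have hG : Measurable fun θ : Params d K => ENNReal.ofReal (Real.exp (r * (⟪x, θ a⟫ - m))) :=
      (Real.measurable_exp.comp (hmeas.const_mul r)).ennreal_ofReal
    have hZ := hint 1 measurable_const
    simp only [Pi.one_apply, mul_one] at hZ
    have hZ0 := Model.lintegral_lik_ne_zero hM.2 h (M.prior K)
    have hZ1 := Model.lintegral_lik_ne_top h (M := M) (M.prior K)
    rw [Model.lintegral_sampleLaw hM.1 hM.2 hM.3 h hG, hint _ hG]
    have htilt := lintegral_exp_mul_gaussian hP b (r • feature T x a)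
    have e : ∀ z : ι → ℝ, r * ((⟪x, T z a⟫ : ℝ) - m)
        = (r • feature T x a) ⬝ᵥ z - (r • feature T x a) ⬝ᵥ P⁻¹.mulVec b := fun z => by
      rw [inner_apply_eq_feature, smul_dotProduct, smul_dotProduct, smul_eq_mul, smul_eq_mul,
        mul_sub]
    simp_rw [e]
    rw [htilt, ← mul_assoc c, ← hZ, ← mul_assoc, ENNReal.inv_mul_cancel hZ0 hZ1, one_mul,
      Matrix.mulVec_smul, smul_dotProduct, dotProduct_smul]
    congr 3
    simp only [smul_eq_mul, hq, posteriorVar, ← hPdef]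
    ring
  have hmeas' : ∀ r : ℝ, Measurable fun θ : Params d K => Real.exp (r * (⟪x, θ a⟫ - m)) :=
    fun r => Real.measurable_exp.comp (hmeas.const_mul r)
  refine ⟨m, fun r => ⟨(hmeas' r).aestronglyMeasurable, ?_⟩, fun r => ?_⟩
  · rw [hasFiniteIntegral_iff_ofReal (Filter.Eventually.of_forall fun _ => (Real.exp_pos _).le),
      key r]
    exact ENNReal.ofReal_lt_top
  · rw [mgf, integral_eq_lintegral_of_nonneg_ae
      (Filter.Eventually.of_forall fun _ => (Real.exp_pos _).le) (hmeas' r).aestronglyMeasurable,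
      key r, ENNReal.toReal_ofReal (Real.exp_pos _).le, Real.coe_toNNReal _ hq0]

end Posterior

/-! ### The log-determinant potential -/

section Potential

variable {ι : Type*} [DecidableEq ι]

theorem precision_snoc {t : ℕ} (v : ℝ) (w : Fin t → ι → ℝ) (u : ι → ℝ) :
    precision v (Fin.snoc w u : Fin (t + 1) → ι → ℝ)
      = precision v w + v⁻¹ • Matrix.vecMulVec u u := by
  simp [precision, Fin.sum_univ_castSucc, smul_add, add_assoc]

variable [Fintype ι]

theorem det_precision_snoc {t : ℕ} {v : ℝ} (hv : 0 ≤ v) (w : Fin t → ι → ℝ) (u : ι → ℝ) :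
    (precision v (Fin.snoc w u : Fin (t + 1) → ι → ℝ)).det
      = (precision v w).det * (1 + v⁻¹ * (u ⬝ᵥ (precision v w)⁻¹.mulVec u)) := by
  have hdet : IsUnit (precision v w).det :=
    (Matrix.isUnit_iff_isUnit_det _).1 (posDef_precision hv w).isUnit
  rw [precision_snoc, ← Matrix.smul_vecMulVec, Matrix.vecMulVec_eq Unit,
    Matrix.det_add_replicateCol_mul_replicateRow hdet]
  congr 1
  rw [Matrix.det_unique, Matrix.add_apply, Matrix.one_apply_eq, Matrix.mul_assoc,
    ← Matrix.replicateCol_mulVec, Matrix.replicateRow_mul_replicateCol_apply, Matrix.mulVec_smul,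
    dotProduct_smul, smul_eq_mul]

theorem log_det_precision_snoc {t : ℕ} {v : ℝ} (hv : 0 ≤ v) (w : Fin t → ι → ℝ) (u : ι → ℝ) :
    Real.log (precision v (Fin.snoc w u : Fin (t + 1) → ι → ℝ)).det
      = Real.log (precision v w).det
        + Real.log (1 + v⁻¹ * (u ⬝ᵥ (precision v w)⁻¹.mulVec u)) := by
  have hq : 0 ≤ u ⬝ᵥ (precision v w)⁻¹.mulVec u := by
    simpa using (posDef_precision hv w).inv.posSemidef.dotProduct_mulVec_nonneg u
  rw [det_precision_snoc hv, Real.log_mul (posDef_precision hv w).det_pos.ne']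
  have := mul_nonneg (inv_nonneg.2 hv) hq
  positivity

theorem log_det_precision_nonneg {t : ℕ} {v : ℝ} (hv : 0 ≤ v) (w : Fin t → ι → ℝ) :
    0 ≤ Real.log (precision v w).det := by
  induction t with
  | zero => simp [precision]
  | succ t ih =>
    have h := log_det_precision_snoc hv (fun i => w i.castSucc) (w (Fin.last t))
    have e : (Fin.snoc (fun i => w i.castSucc) (w (Fin.last t)) : Fin (t + 1) → ι → ℝ) = w :=
      Fin.snoc_init_self w
    have hq : 0 ≤ w (Fin.last t) ⬝ᵥ (precision v fun i => w i.castSucc)⁻¹.mulVec (w (Fin.last t)) := by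
      simpa using
        (posDef_precision hv fun i => w i.castSucc).inv.posSemidef.dotProduct_mulVec_nonneg
          (w (Fin.last t))
    rw [e] at h
    rw [h]
    have := mul_nonneg (inv_nonneg.2 hv) hq
    exact add_nonneg (ih _) (Real.log_nonneg (by linarith))

/-- The posterior covariance is at most the prior covariance. -/
theorem dotProduct_inv_precision_mulVec_le {t : ℕ} {v : ℝ} (hv : 0 ≤ v) (w : Fin t → ι → ℝ)
    (u : ι → ℝ) : u ⬝ᵥ (precision v w)⁻¹.mulVec u ≤ u ⬝ᵥ u := by
  set P := precision v w with hP
  have hdet : IsUnit P.det := (Matrix.isUnit_iff_isUnit_det _).1 (posDef_precision hv w).isUnit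
  set e := P⁻¹.mulVec u with he
  have hPe : P.mulVec e = u := by
    rw [he, Matrix.mulVec_mulVec, Matrix.mul_nonsing_inv _ hdet, Matrix.one_mulVec]
  have h1 : e ⬝ᵥ e ≤ u ⬝ᵥ e := by
    have h := dotProduct_precision_mulVec v w e
    rw [← hP, hPe, dotProduct_comm] at h
    rw [h]
    have : 0 ≤ v⁻¹ * ∑ i, (w i ⬝ᵥ e) ^ 2 :=
      mul_nonneg (inv_nonneg.2 hv) (Finset.sum_nonneg fun i _ => sq_nonneg _)
    linarith
  have h2 : 0 ≤ (u - e) ⬝ᵥ (u - e) := by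
    simpa using dotProduct_star_self_nonneg (u - e)
  rw [sub_dotProduct, dotProduct_sub, dotProduct_sub, dotProduct_comm e u] at h2
  linarith

theorem trace_precision {t : ℕ} (v : ℝ) (w : Fin t → ι → ℝ) :
    (precision v w).trace = Fintype.card ι + v⁻¹ * ∑ i, w i ⬝ᵥ w i := by
  simp [precision, Matrix.trace_add, Matrix.trace_smul, Matrix.trace_sum, Matrix.trace_vecMulVec]

/-- Concavity of the logarithm bounds the log-determinant by the trace. -/
theorem log_det_precision_le {t : ℕ} {v γ : ℝ} (hv : 0 ≤ v) (w : Fin t → ι → ℝ)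
    (hw : ∀ i, w i ⬝ᵥ w i ≤ γ) (hγ : 0 ≤ γ) (hι : 0 < Fintype.card ι) :
    Real.log (precision v w).det
      ≤ Fintype.card ι * Real.log (1 + t * γ / (Fintype.card ι * v)) := by
  set N : ℝ := (Fintype.card ι : ℝ) with hN
  have hN0 : 0 < N := Nat.cast_pos.2 hι
  set c : ℝ := 1 + t * γ / (N * v) with hc
  have hc0 : 0 < c := by positivity
  have hP := posDef_precision hv w
  have htr : (precision v w).trace ≤ N * c := by
    rw [trace_precision, hc, mul_add, mul_one]
    have h1 : ∑ i, w i ⬝ᵥ w i ≤ t * γ := by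
      simpa using Finset.sum_le_card_nsmul Finset.univ (fun i => w i ⬝ᵥ w i) γ fun i _ => hw i
    have h2 : N * (t * γ / (N * v)) = v⁻¹ * (t * γ) := by
      rw [mul_div_assoc', mul_div_mul_left _ _ hN0.ne', div_eq_inv_mul]
    rw [h2]
    gcongr
  rw [hP.isHermitian.det_eq_prod_eigenvalues]
  simp only [RCLike.ofReal_real_eq_id, id_eq]
  rw [Real.log_prod fun i _ => (hP.eigenvalues_pos i).ne']
  have h3 : ∀ i, Real.log (hP.isHermitian.eigenvalues i)
      ≤ Real.log c + (hP.isHermitian.eigenvalues i / c - 1) := fun i => by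
    have h4 := Real.log_le_sub_one_of_pos (div_pos (hP.eigenvalues_pos i) hc0)
    rw [Real.log_div (hP.eigenvalues_pos i).ne' hc0.ne'] at h4
    linarith
  refine (Finset.sum_le_sum fun i _ => h3 i).trans ?_
  have h5 : ∑ i, hP.isHermitian.eigenvalues i = (precision v w).trace := by
    rw [hP.isHermitian.trace_eq_sum_eigenvalues]; simp
  rw [Finset.sum_add_distrib, Finset.sum_sub_distrib, ← Finset.sum_div, h5]
  have h6 : (precision v w).trace / c ≤ N := (div_le_iff₀ hc0).2 htr
  simp only [Finset.sum_const, Finset.card_univ, nsmul_eq_mul, mul_one, ← hN]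
  linarith

/-- On `[0, γ]` a variance is controlled by the logarithmic gain of information. -/
theorem le_mul_log_one_add {q γ v : ℝ} (hq : 0 ≤ q) (hqγ : q ≤ γ) (hv : 0 < v) :
    q ≤ (v + γ) * Real.log (1 + v⁻¹ * q) := by
  have h1 : 0 < 1 + v⁻¹ * q := by positivity
  have h2 := Real.one_sub_inv_le_log_of_pos h1
  have h3 : q / (v + q) = 1 - (1 + v⁻¹ * q)⁻¹ := by
    field_simp
    ring
  rw [← h3] at h2
  have h4 : q ≤ (v + γ) * (q / (v + q)) := by
    rw [mul_div_assoc', le_div_iff₀ (by positivity)]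
    nlinarith
  exact h4.trans (mul_le_mul_of_nonneg_left h2 (by linarith))

end Potential

/-! ### The regret of one round -/

theorem integrable_apply_index {Ω : Type*} [MeasurableSpace Ω] {π : Measure Ω} {K : ℕ}
    {g : Fin K → Ω → ℝ} (hg : ∀ a, Measurable (g a)) (hi : ∀ a, Integrable (g a) π)
    {A : Ω → Fin K} (hA : Measurable A) : Integrable (fun ω => g (A ω) ω) π := by
  have hm : Measurable fun ω => g (A ω) ω := by
    have : Measurable fun p : Ω × Fin K => g p.2 p.1 := measurable_from_prod_countable_left hg
    exact this.comp (measurable_id.prodMk hA)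
  refine (integrable_finsetSum Finset.univ fun a _ => (hi a).abs).mono' hm.aestronglyMeasurable
    (Filter.Eventually.of_forall fun ω => ?_)
  exact Finset.single_le_sum (f := fun a => |g a ω|) (fun a _ => abs_nonneg _) (Finset.mem_univ _)

/-- The maximum of `K` sub-Gaussian variables exceeds its mean by at most `log K / r` plus `r / 2`
times the variance proxy at the maximiser. The argmax may be replaced by any random index. -/
theorem integral_sub_le_of_hasSubgaussianMGF {Ω : Type*} [MeasurableSpace Ω] {π : Measure Ω}
    [IsProbabilityMeasure π] {K : ℕ} [NeZero K] {g : Fin K → Ω → ℝ} (hg : ∀ a, Measurable (g a))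
    {m q : Fin K → ℝ} (hq : ∀ a, 0 ≤ q a)
    (hs : ∀ a, HasSubgaussianMGF (fun ω => g a ω - m a) (q a).toNNReal π) {r : ℝ} (hr : 0 < r)
    {A : Ω → Fin K} (hA : Measurable A) :
    ∫ ω, (g (A ω) ω - m (A ω)) ∂π ≤ ∫ ω, (Real.log K / r + r / 2 * q (A ω)) ∂π := by
  have hK : (0 : ℝ) < K := by exact_mod_cast Nat.pos_of_ne_zero (NeZero.ne K)
  set e : Fin K → Ω → ℝ := fun a ω => Real.exp (r * (g a ω - m a)) * Real.exp (-(r ^ 2 * q a / 2))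
    with he
  have hei : ∀ a, Integrable (e a) π := fun a => ((hs a).integrable_exp_mul r).mul_const _
  have hei1 : ∀ a, ∫ ω, e a ω ∂π ≤ 1 := fun a => by
    rw [integral_mul_const]
    have h := (hs a).mgf_le r
    rw [mgf, Real.coe_toNNReal _ (hq a)] at h
    refine (mul_le_mul_of_nonneg_right h (Real.exp_pos _).le).trans (le_of_eq ?_)
    rw [← Real.exp_add, Real.exp_eq_one_iff]
    ring
  -- the tangent of the logarithm at `K`
  have hpt : ∀ ω, g (A ω) ω - m (A ω)
      ≤ (Real.log K / r + r / 2 * q (A ω)) + ((∑ a, e a ω) / K - 1) / r := fun ω => by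
    set u := r * (g (A ω) ω - m (A ω)) - r ^ 2 * q (A ω) / 2 with hu
    have h1 := Real.add_one_le_exp (u - Real.log K)
    rw [Real.exp_sub, Real.exp_log hK] at h1
    have h2 : Real.exp u = e (A ω) ω := by
      simp only [he]
      rw [← Real.exp_add, hu, sub_eq_add_neg]
    have h3 : e (A ω) ω ≤ ∑ a, e a ω :=
      Finset.single_le_sum (f := fun a => e a ω) (fun a _ => by positivity) (Finset.mem_univ _)
    have h4 : Real.exp u / K ≤ (∑ a, e a ω) / K := by
      rw [h2]; gcongr
    have h5 : g (A ω) ω - m (A ω) = (u + r ^ 2 * q (A ω) / 2) / r := by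
      rw [hu]; field_simp; ring
    have h6 : (Real.log K / r + r / 2 * q (A ω)) + ((∑ a, e a ω) / K - 1) / r
        = (Real.log K + ((∑ a, e a ω) / K - 1) + r ^ 2 * q (A ω) / 2) / r := by
      field_simp; ring
    rw [h5, h6]
    gcongr
    linarith
  have hi1 : Integrable (fun ω => Real.log K / r + r / 2 * q (A ω)) π :=
    (integrable_const _).add ((integrable_apply_index (g := fun a _ => q a)
      (fun a => measurable_const) (fun a => integrable_const _) hA).const_mul _)
  have hsum : Integrable (fun ω => ∑ a, e a ω) π := integrable_finsetSum _ fun a _ => hei a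
  have hi2 : Integrable (fun ω => ((∑ a, e a ω) / K - 1) / r) π :=
    ((hsum.div_const _).sub (integrable_const _)).div_const _
  have hi0 : Integrable (fun ω => g (A ω) ω - m (A ω)) π :=
    integrable_apply_index (g := fun a ω => g a ω - m a) (fun a => (hg a).sub_const _)
      (fun a => (hs a).integrable) hA
  refine (integral_mono hi0 (hi1.add hi2) hpt).trans ?_
  simp only [Pi.add_apply]
  rw [integral_add hi1 hi2]
  have h7 : ∫ ω, ((∑ a, e a ω) / K - 1) / r ∂π ≤ 0 := by
    rw [integral_div, integral_sub (hsum.div_const _) (integrable_const _), integral_div,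
      integral_finsetSum _ fun a _ => hei a]
    refine div_nonpos_of_nonpos_of_nonneg ?_ hr.le
    have h8 : ∑ a, ∫ ω, e a ω ∂π ≤ K := by
      simpa using Finset.sum_le_card_nsmul Finset.univ (fun a => ∫ ω, e a ω ∂π) 1 fun a _ => hei1 a
    have h9 : (∑ a, ∫ ω, e a ω ∂π) / K ≤ 1 := (div_le_one hK).2 h8
    simpa using h9
  linarith

/-- The regret of posterior sampling in one round: when the sampled index maximises an independent
copy `g · ω'` of the true values `g · ω`, the two maximisers have the same law. -/
theorem lintegral_regret_le {Ω : Type*} [MeasurableSpace Ω] {π : Measure Ω}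
    [IsProbabilityMeasure π] {K : ℕ} [NeZero K] {g : Fin K → Ω → ℝ} (hg : ∀ a, Measurable (g a))
    {m q : Fin K → ℝ} (hq : ∀ a, 0 ≤ q a)
    (hs : ∀ a, HasSubgaussianMGF (fun ω => g a ω - m a) (q a).toNNReal π) {r : ℝ} (hr : 0 < r)
    {A : Ω → Fin K} (hA : Measurable A) (hmax : ∀ ω b, g b ω ≤ g (A ω) ω) :
    ∫⁻ ω, ∫⁻ ω', ENNReal.ofReal (g (A ω) ω - g (A ω') ω) ∂π ∂π
      ≤ ∫⁻ ω', ENNReal.ofReal (Real.log K / r + r / 2 * q (A ω')) ∂π := by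
  have hK : (1 : ℝ) ≤ K := by exact_mod_cast Nat.one_le_iff_ne_zero.2 (NeZero.ne K)
  have hgi : ∀ a, Integrable (g a) π := fun a => by
    refine ((hs a).integrable.add (integrable_const (m a))).congr
      (Filter.Eventually.of_forall fun ω => ?_)
    simp
  have hgA : Integrable (fun ω => g (A ω) ω) π := integrable_apply_index hg hgi hA
  have hmean : ∀ a, ∫ ω, g a ω ∂π = m a := fun a => by
    have h := integral_eq_zero_of_hasSubgaussianMGF (hs a)
    rw [integral_sub (hgi a) (integrable_const _)] at h
    simpa [sub_eq_zero] using h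
  have hjoint : Measurable fun p : Ω × Fin K => g p.2 p.1 := measurable_from_prod_countable_left hg
  have hmA : Integrable (fun ω => m (A ω)) π := integrable_apply_index (g := fun a _ => m a)
      (fun a => measurable_const) (fun a => integrable_const _) hA
  rw [lintegral_lintegral_swap]
  · have h1 : ∀ ω', ∫⁻ ω, ENNReal.ofReal (g (A ω) ω - g (A ω') ω) ∂π
        = ENNReal.ofReal ((∫ ω, g (A ω) ω ∂π) - m (A ω')) := fun ω' => by
      rw [← ofReal_integral_eq_lintegral_ofReal
          (show Integrable (fun ω => g (A ω) ω - g (A ω') ω) π from hgA.sub (hgi _))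
        (Filter.Eventually.of_forall fun ω => sub_nonneg.2 (hmax ω _)),
        integral_sub hgA (hgi _), hmean]
    have h2 : ∀ ω', 0 ≤ (∫ ω, g (A ω) ω ∂π) - m (A ω') := fun ω' => by
      rw [sub_nonneg, ← hmean]
      exact integral_mono (hgi _) hgA fun ω => hmax ω _
    have h3 : Integrable (fun ω => Real.log K / r + r / 2 * q (A ω)) π :=
      (integrable_const _).add ((integrable_apply_index (g := fun a _ => q a)
        (fun a => measurable_const) (fun a => integrable_const _) hA).const_mul _)
    simp_rw [h1]
    rw [← ofReal_integral_eq_lintegral_ofReal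
        (show Integrable (fun ω' => (∫ ω, g (A ω) ω ∂π) - m (A ω')) π from
          (integrable_const _).sub hmA)
        (Filter.Eventually.of_forall h2),
      ← ofReal_integral_eq_lintegral_ofReal h3 (Filter.Eventually.of_forall fun ω =>
        add_nonneg (div_nonneg (Real.log_nonneg hK) hr.le)
          (mul_nonneg (by positivity) (hq _)))]
    refine ENNReal.ofReal_le_ofReal ?_
    rw [integral_sub (integrable_const _) hmA]
    simp only [integral_const, probReal_univ, one_smul]
    rw [← integral_sub hgA hmA]
    exact integral_sub_le_of_hasSubgaussianMGF hg hq hs hr hA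
  · refine (Measurable.ennreal_ofReal ?_).aemeasurable
    exact (hjoint.comp (measurable_fst.prodMk (hA.comp measurable_fst))).sub
      (hjoint.comp (measurable_fst.prodMk (hA.comp measurable_snd)))

/-! ### Regret over many rounds -/

namespace Model

variable {d K : ℕ} [NeZero K] {M : Model d}

/-- The regret of playing the action that is greedy for `z.2` in the context `z.1`. -/
noncomputable def roundRegret (M : Model d) (θ : Params d K) (z : Vec d × Params d K) : ℝ :=
  ⟪z.1, θ (M.bestAction z.1 θ)⟫ - ⟪z.1, θ (M.bestAction z.1 z.2)⟫

theorem inner_le_bestAction (x : Vec d) (θ : Params d K) (b : Fin K) :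
    (⟪x, θ b⟫ : ℝ) ≤ ⟪x, θ (M.bestAction x θ)⟫ := by
  rw [bestAction_eq]
  exact argmax_spec (fun a => (⟪x, θ a⟫ : ℝ)) b

theorem roundRegret_nonneg (θ : Params d K) (z : Vec d × Params d K) :
    0 ≤ M.roundRegret θ z := sub_nonneg.2 (inner_le_bestAction _ _ _)

theorem measurable_roundRegret {α : Type*} [MeasurableSpace α] {θ : α → Params d K}
    {z : α → Vec d × Params d K} (hθ : Measurable θ) (hz : Measurable z) :
    Measurable fun a => M.roundRegret (θ a) (z a) :=
  (hz.fst.inner (measurable_eval_params hθ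
    (measurable_bestAction.comp (hz.fst.prodMk hθ)))).sub
    (hz.fst.inner (measurable_eval_params hθ (measurable_bestAction.comp hz)))

theorem regret_nonneg {n : ℕ} (p : Params d K × History d K n) : 0 ≤ M.regret p :=
  Finset.sum_nonneg fun t _ => by
    rw [meanReward_eq, meanReward_eq]
    exact sub_nonneg.2 (inner_le_bestAction _ _ _)

theorem measurable_regret {n : ℕ} :
    Measurable fun p : Params d K × History d K n => M.regret p := by
  unfold regret
  simp_rw [meanReward_eq]
  refine Finset.measurable_fun_sum _ fun t _ => ?_
  have h1 : Measurable fun p : Params d K × History d K n => p.2 t :=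
    (measurable_pi_apply t).comp measurable_snd
  exact (h1.fst.inner (measurable_eval_params measurable_fst
    (measurable_bestAction.comp (h1.fst.prodMk measurable_fst)))).sub
    (h1.fst.inner (measurable_eval_params measurable_fst h1.snd.fst))

theorem regret_extend {t : ℕ} (θ : Params d K) (h : History d K t) (z : Vec d × Params d K)
    (y : ℝ) : M.regret (θ, M.extend h z y) = M.regret (θ, h) + M.roundRegret θ z := by
  simp [regret, roundRegret, extend, Fin.sum_univ_castSucc, meanReward_eq]
  ring

theorem Regular.isProbabilityMeasure_runLaw (hM : M.Regular)
    (ctx : (t : ℕ) → Kernel (History d K t) (Vec d)) [∀ t, IsMarkovKernel (ctx t)] (t : ℕ) :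
    IsProbabilityMeasure (M.runLaw ctx t) := by
  have hs := fun (t : ℕ) (h : History d K t) => hM.isProbabilityMeasure_sampleLaw h
  induction t with
  | zero =>
    have := isProbabilityMeasure_prior (K := K) hM.1 hM.3
    exact Measure.isProbabilityMeasure_map (measurable_id.prodMk measurable_const).aemeasurable
  | succ t ih =>
    constructor
    have := hM.lintegral_runLaw_succ ctx t (F := fun _ => 1) measurable_const
    simpa using this

theorem Regular.ae_norm_context (hM : M.Regular)
    (ctx : (t : ℕ) → Kernel (History d K t) (Vec d)) [∀ t, IsMarkovKernel (ctx t)]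
    (hctx : ∀ t h, ∀ᵐ x ∂(ctx t h), ‖x‖ = 1) (n : ℕ) :
    ∀ᵐ p ∂(M.runLaw ctx n), ∀ i, ‖(p.2 i).1‖ = 1 := by
  have hs := fun (t : ℕ) (h : History d K t) => hM.isProbabilityMeasure_sampleLaw h
  have hset : ∀ t, MeasurableSet {p : Params d K × History d K t | ∀ i, ‖(p.2 i).1‖ = 1} := by
    intro t
    rw [Set.ofPred_forall]
    refine MeasurableSet.iInter fun i => ?_
    exact measurableSet_eq_fun (((measurable_pi_apply i).comp measurable_snd).fst.norm)
      measurable_const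
  induction n with
  | zero => exact Filter.Eventually.of_forall fun p i => i.elim0
  | succ t ih =>
    have hm := (hset (t + 1)).compl
    rw [ae_iff]
    change M.runLaw ctx (t + 1) {p | ∀ i, ‖(p.2 i).1‖ = 1}ᶜ = 0
    rw [← lintegral_indicator_one hm, hM.lintegral_runLaw_succ ctx t
      (measurable_one.indicator hm)]
    refine lintegral_eq_zero_of_ae_eq_zero ?_
    filter_upwards [ih] with p hp
    refine lintegral_eq_zero_of_ae_eq_zero ?_
    filter_upwards [Measure.quasiMeasurePreserving_fst.ae (hctx t p.2)] with z hz
    refine lintegral_eq_zero_of_ae_eq_zero (Filter.Eventually.of_forall fun y => ?_)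
    refine Set.indicator_of_notMem ?_ _
    simp only [Set.mem_compl_iff, Set.mem_ofPred_eq, not_not]
    intro i
    refine Fin.lastCases ?_ (fun j => ?_) i
    · simpa [extend] using hz
    · simpa [extend] using hp j

/-- The expected regret of one round given the past, when the context has law `ξ`. -/
theorem Regular.lintegral_roundRegret_le (hM : M.Regular) {t : ℕ} (h : History d K t)
    (ξ : Measure (Vec d)) [IsProbabilityMeasure ξ] {q : Vec d → Fin K → ℝ}
    (hq0 : ∀ x a, 0 ≤ q x a)
    (hq : ∀ x a, ∃ m : ℝ, HasSubgaussianMGF (fun θ : Params d K => ⟪x, θ a⟫ - m)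
      (q x a).toNNReal (M.sampleLaw h))
    (hqm : ∀ a, Measurable fun x => q x a) {r : ℝ} (hr : 0 < r) :
    ∫⁻ θ, ∫⁻ z, ENNReal.ofReal (M.roundRegret θ z) ∂(ξ.prod (M.sampleLaw h)) ∂(M.sampleLaw h)
      ≤ ∫⁻ z, ENNReal.ofReal (Real.log K / r + r / 2 * q z.1 (M.bestAction z.1 z.2))
        ∂(ξ.prod (M.sampleLaw h)) := by
  have hs := hM.isProbabilityMeasure_sampleLaw h
  have hm : Measurable fun w : Params d K × (Vec d × Params d K) =>
      ENNReal.ofReal (M.roundRegret w.1 w.2) :=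
    (measurable_roundRegret measurable_fst measurable_snd).ennreal_ofReal
  have hq2 : Measurable fun w : Vec d × Fin K => q w.1 w.2 :=
    measurable_from_prod_countable_left hqm
  have hqz : Measurable fun z : Vec d × Params d K =>
      ENNReal.ofReal (Real.log K / r + r / 2 * q z.1 (M.bestAction z.1 z.2)) :=
    (((hq2.comp (measurable_fst.prodMk measurable_bestAction)).const_mul _).const_add
      _).ennreal_ofReal
  rw [lintegral_lintegral_swap hm.aemeasurable, lintegral_prod _
    (hm.lintegral_prod_left').aemeasurable, lintegral_prod _ hqz.aemeasurable]
  refine lintegral_mono fun x => ?_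
  choose m hm' using hq x
  have hA : Measurable fun θ : Params d K => M.bestAction x θ :=
    measurable_bestAction_comp measurable_const measurable_id
  have hz : Measurable fun w : Params d K × Params d K => (x, w.2) :=
    measurable_const.prodMk measurable_snd
  have hx : Measurable fun w : Params d K × Params d K =>
      ENNReal.ofReal (M.roundRegret w.1 (x, w.2)) :=
    (measurable_roundRegret measurable_fst hz).ennreal_ofReal
  have h1 := DiffusionTS.lintegral_regret_le (π := M.sampleLaw h) (m := m) (q := q x)
    (g := fun a θ => (⟪x, θ a⟫ : ℝ)) (A := fun θ => M.bestAction x θ)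
    (fun a => measurable_const.inner (measurable_pi_apply a)) (hq0 x) hm' hr hA
    fun θ b => inner_le_bestAction x θ b
  rw [lintegral_lintegral_swap (f := fun θ' θ => ENNReal.ofReal (M.roundRegret θ (x, θ')))
    (hx.comp measurable_swap).aemeasurable]
  exact h1

/-- A potential whose increments dominate the posterior variances of the actions played bounds
the expected regret. -/
theorem Regular.lintegral_regret_le (hM : M.Regular)
    (ctx : (t : ℕ) → Kernel (History d K t) (Vec d)) [∀ t, IsMarkovKernel (ctx t)]
    (hctx : ∀ t h, ∀ᵐ x ∂(ctx t h), ‖x‖ = 1)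
    {q : (t : ℕ) → History d K t → Vec d → Fin K → ℝ} (hq0 : ∀ t h x a, 0 ≤ q t h x a)
    (hq : ∀ t h x a, ∃ m : ℝ, HasSubgaussianMGF (fun θ : Params d K => ⟪x, θ a⟫ - m)
      (q t h x a).toNNReal (M.sampleLaw h))
    (hqm : ∀ t h a, Measurable fun x => q t h x a)
    {G : (t : ℕ) → History d K t → ℝ} (hGm : ∀ t, Measurable (G t)) (hG0 : ∀ t h, 0 ≤ G t h)
    (hG : ∀ t h x a y, ‖x‖ = 1 →
      G t h + q t h x a ≤ G (t + 1) (Fin.snoc h (x, a, y) : History d K (t + 1)))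
    {r : ℝ} (hr : 0 < r) (n : ℕ) :
    ∫⁻ p, ENNReal.ofReal (M.regret p) ∂(M.runLaw ctx n)
      ≤ ∫⁻ p, ENNReal.ofReal (n * (Real.log K / r) + r / 2 * G n p.2) ∂(M.runLaw ctx n) := by
  have hs := fun (t : ℕ) (h : History d K t) => hM.isProbabilityMeasure_sampleLaw h
  have hK : (1 : ℝ) ≤ K := by exact_mod_cast Nat.one_le_iff_ne_zero.2 (NeZero.ne K)
  have hc : 0 ≤ Real.log K / r := div_nonneg (Real.log_nonneg hK) hr.le
  induction n with
  | zero => simp [regret]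
  | succ t ih =>
    set c := Real.log K / r with hcdef
    have hk : ∀ p : Params d K × History d K t,
        IsProbabilityMeasure ((ctx t p.2).prod (M.sampleLaw p.2)) := fun p => inferInstance
    have hround : Measurable fun p : Params d K × History d K t =>
        ∫⁻ z, ENNReal.ofReal (M.roundRegret p.1 z) ∂((ctx t p.2).prod (M.sampleLaw p.2)) := by
      let k : Kernel (Params d K × History d K t) (Vec d × Params d K) :=
        ((ctx t) ×ₖ ⟨_, hM.measurable_sampleLaw⟩).comap Prod.snd measurable_snd
      have : IsMarkovKernel
          (⟨_, hM.measurable_sampleLaw⟩ : Kernel (History d K t) (Params d K)) := ⟨hs t⟩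
      have hk' : ∀ p, k p = (ctx t p.2).prod (M.sampleLaw p.2) := fun p => by
        rw [Kernel.comap_apply, Kernel.prod_apply]; rfl
      have : IsMarkovKernel k := ⟨fun q => by rw [hk']; infer_instance⟩
      simp_rw [← hk']
      exact Measurable.lintegral_kernel_prod_right (κ := k)
        (f := fun p z => ENNReal.ofReal (M.roundRegret p.1 z))
        (measurable_roundRegret measurable_fst.fst measurable_snd).ennreal_ofReal
    have hstep := fun p : Params d K × History d K t =>
      hM.lintegral_roundRegret_le p.2 (ctx t p.2) (hq0 t p.2) (hq t p.2) (hqm t p.2) hr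
    have hGm' : Measurable fun p : Params d K × History d K (t + 1) =>
        ENNReal.ofReal ((t + 1 : ℕ) * c + r / 2 * G (t + 1) p.2) :=
      ((((hGm (t + 1)).comp measurable_snd).const_mul _).const_add _).ennreal_ofReal
    rw [hM.lintegral_runLaw_succ ctx t measurable_regret.ennreal_ofReal,
      hM.lintegral_runLaw_succ ctx t hGm']
    calc ∫⁻ p, ∫⁻ z, ∫⁻ y, ENNReal.ofReal (M.regret (p.1, M.extend p.2 z y))
          ∂(M.rewardLaw z.1 (p.1 (M.bestAction z.1 z.2)))
          ∂((ctx t p.2).prod (M.sampleLaw p.2)) ∂(M.runLaw ctx t)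
        = ∫⁻ p, (ENNReal.ofReal (M.regret p) + ∫⁻ z, ENNReal.ofReal (M.roundRegret p.1 z)
            ∂((ctx t p.2).prod (M.sampleLaw p.2))) ∂(M.runLaw ctx t) := by
          refine lintegral_congr fun p => ?_
          simp_rw [regret_extend, ENNReal.ofReal_add (regret_nonneg _) (roundRegret_nonneg _ _)]
          simp only [lintegral_const, measure_univ, mul_one]
          rw [lintegral_add_left measurable_const]
          simp
      _ = ∫⁻ p, ENNReal.ofReal (M.regret p) ∂(M.runLaw ctx t)
          + ∫⁻ p, ∫⁻ θ, ∫⁻ z, ENNReal.ofReal (M.roundRegret θ z)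
            ∂((ctx t p.2).prod (M.sampleLaw p.2)) ∂(M.sampleLaw p.2) ∂(M.runLaw ctx t) := by
          rw [lintegral_add_left measurable_regret.ennreal_ofReal,
            hM.lintegral_runLaw_eq_sampleLaw ctx t hround]
      _ ≤ ∫⁻ p, ENNReal.ofReal (t * c + r / 2 * G t p.2) ∂(M.runLaw ctx t)
          + ∫⁻ p, ∫⁻ z, ENNReal.ofReal (c + r / 2 * q t p.2 z.1 (M.bestAction z.1 z.2))
            ∂((ctx t p.2).prod (M.sampleLaw p.2)) ∂(M.runLaw ctx t) :=
          add_le_add ih (lintegral_mono hstep)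
      _ = ∫⁻ p, (ENNReal.ofReal (t * c + r / 2 * G t p.2)
          + ∫⁻ z, ENNReal.ofReal (c + r / 2 * q t p.2 z.1 (M.bestAction z.1 z.2))
            ∂((ctx t p.2).prod (M.sampleLaw p.2))) ∂(M.runLaw ctx t) := by
          refine (lintegral_add_left ?_ _).symm
          exact ((((hGm t).comp measurable_snd).const_mul _).const_add _).ennreal_ofReal
      _ ≤ _ := by
          refine lintegral_mono fun p => ?_
          have h1 : ENNReal.ofReal (t * c + r / 2 * G t p.2)
              = ∫⁻ _z, ENNReal.ofReal (t * c + r / 2 * G t p.2)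
                ∂((ctx t p.2).prod (M.sampleLaw p.2)) := by simp
          rw [h1, ← lintegral_add_left measurable_const]
          refine lintegral_mono_ae ?_
          filter_upwards [Measure.quasiMeasurePreserving_fst.ae (hctx t p.2)] with z hz
          have h2 : ∀ y, ENNReal.ofReal (t * c + r / 2 * G t p.2)
              + ENNReal.ofReal (c + r / 2 * q t p.2 z.1 (M.bestAction z.1 z.2))
              ≤ ENNReal.ofReal ((t + 1 : ℕ) * c + r / 2 * G (t + 1) (M.extend p.2 z y)) := by
            intro y
            have h3 := hG t p.2 z.1 (M.bestAction z.1 z.2) y hz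
            rw [← ENNReal.ofReal_add (add_nonneg (mul_nonneg (Nat.cast_nonneg _) hc)
                (mul_nonneg (by positivity) (hG0 _ _)))
              (add_nonneg hc (mul_nonneg (by positivity) (hq0 _ _ _ _)))]
            refine ENNReal.ofReal_le_ofReal ?_
            have h4 := mul_le_mul_of_nonneg_left h3 (by positivity : 0 ≤ r / 2)
            rw [Nat.cast_add, Nat.cast_one]
            unfold extend
            linarith
          calc _ = ∫⁻ _y, (ENNReal.ofReal (t * c + r / 2 * G t p.2)
                + ENNReal.ofReal (c + r / 2 * q t p.2 z.1 (M.bestAction z.1 z.2)))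
                ∂(M.rewardLaw z.1 (p.1 (M.bestAction z.1 z.2))) := by simp
            _ ≤ _ := lintegral_mono h2

theorem Regular.integrable_regret_and_bayesRegret_le (hM : M.Regular)
    (ctx : (t : ℕ) → Kernel (History d K t) (Vec d)) [∀ t, IsMarkovKernel (ctx t)]
    (hctx : ∀ t h, ∀ᵐ x ∂(ctx t h), ‖x‖ = 1)
    {q : (t : ℕ) → History d K t → Vec d → Fin K → ℝ} (hq0 : ∀ t h x a, 0 ≤ q t h x a)
    (hq : ∀ t h x a, ∃ m : ℝ, HasSubgaussianMGF (fun θ : Params d K => ⟪x, θ a⟫ - m)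
      (q t h x a).toNNReal (M.sampleLaw h))
    (hqm : ∀ t h a, Measurable fun x => q t h x a)
    {G : (t : ℕ) → History d K t → ℝ} (hGm : ∀ t, Measurable (G t)) (hG0 : ∀ t h, 0 ≤ G t h)
    (hG : ∀ t h x a y, ‖x‖ = 1 →
      G t h + q t h x a ≤ G (t + 1) (Fin.snoc h (x, a, y) : History d K (t + 1)))
    {r : ℝ} (hr : 0 < r) (n : ℕ) {B : ℝ} (hB0 : 0 ≤ B)
    (hB : ∀ h : History d K n, (∀ i, ‖(h i).1‖ = 1) → G n h ≤ B) :
    Integrable M.regret (M.runLaw ctx n) ∧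
      M.bayesRegret ctx n ≤ n * (Real.log K / r) + r / 2 * B := by
  have hK : (1 : ℝ) ≤ K := by exact_mod_cast Nat.one_le_iff_ne_zero.2 (NeZero.ne K)
  have hc : 0 ≤ Real.log K / r := div_nonneg (Real.log_nonneg hK) hr.le
  have hp := hM.isProbabilityMeasure_runLaw ctx n
  have hbound : ∫⁻ p, ENNReal.ofReal (M.regret p) ∂(M.runLaw ctx n)
      ≤ ENNReal.ofReal (n * (Real.log K / r) + r / 2 * B) := by
    refine (hM.lintegral_regret_le ctx hctx hq0 hq hqm hGm hG0 hG hr n).trans ?_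
    refine (lintegral_mono_ae (g := fun _ => ENNReal.ofReal (n * (Real.log K / r) + r / 2 * B))
      ?_).trans (by simp)
    filter_upwards [hM.ae_norm_context ctx hctx n] with p hp
    refine ENNReal.ofReal_le_ofReal ?_
    have := mul_le_mul_of_nonneg_left (hB p.2 hp) (by positivity : 0 ≤ r / 2)
    linarith
  have hnn : 0 ≤ᵐ[M.runLaw ctx n] fun p => M.regret p :=
    Filter.Eventually.of_forall regret_nonneg
  refine ⟨⟨measurable_regret.aestronglyMeasurable, ?_⟩, ?_⟩
  · rw [hasFiniteIntegral_iff_ofReal hnn]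
    exact hbound.trans_lt ENNReal.ofReal_lt_top
  · rw [bayesRegret, integral_eq_lintegral_of_nonneg_ae hnn measurable_regret.aestronglyMeasurable]
    exact ENNReal.toReal_le_of_le_ofReal (by positivity) hbound

end Model

theorem regular_linearModel {d : ℕ} {L : ℕ} (hL : 1 ≤ L) (W : ℕ → Matrix (Fin d) (Fin d) ℝ)
    (s : ℕ → ℝ) {σ : ℝ} (hσ : 0 < σ) : (linearModel L W s σ).Regular where
  measurable_f := fun ℓ => (Matrix.toEuclideanCLM (𝕜 := ℝ) (W ℓ)).measurable
  noiseVar_ne_zero := by simp [Model.noiseVar, linearModel, hσ.ne']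
  one_le_L := hL

theorem pos_of_unitMixing {d L : ℕ} {W : ℕ → Matrix (Fin d) (Fin d) ℝ} (hL : 1 ≤ L)
    (hW : UnitMixing L W) : 0 < d := by
  obtain ⟨v, -, hv⟩ := (hW 1 (Finset.mem_Icc.2 ⟨le_rfl, hL⟩)).1.exists_hasEigenvector
  by_contra! h
  obtain rfl : d = 0 := by omega
  exact hv (Subsingleton.elim _ _)

theorem measurable_log_det_precision {ι : Type*} [Fintype ι] [DecidableEq ι] {d K t : ℕ}
    (T : (ι → ℝ) →ₗ[ℝ] Params d K) (v : ℝ) :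
    Measurable fun h : History d K t =>
      Real.log (precision v fun i => feature T (h i).1 (h i).2.1).det := by
  have hf : ∀ (i : Fin t) (j : ι),
      Measurable fun h : History d K t => feature T (h i).1 (h i).2.1 j := fun i j => by
    have h1 : Measurable fun h : History d K t => h i := measurable_pi_apply i
    exact h1.fst.inner ((Measurable.of_discrete (f := fun a => T (Pi.single j 1) a)).comp h1.snd.fst)
  refine Real.measurable_log.comp ?_
  simp_rw [Matrix.det_apply']
  refine Finset.measurable_fun_sum _ fun τ _ => measurable_const.mul ?_
  refine Finset.measurable_fun_prod _ fun j _ => ?_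
  simp only [precision, Matrix.add_apply, Matrix.smul_apply, Matrix.sum_apply,
    Matrix.vecMulVec_apply]
  have hsum : ∀ j k, Measurable fun h : History d K t =>
      ∑ i, feature T (h i).1 (h i).2.1 j * feature T (h i).1 (h i).2.1 k := fun j k =>
    Finset.measurable_fun_sum _ fun i _ => (hf i j).mul (hf i k)
  exact ((hsum _ _).const_smul v⁻¹).const_add _

/-- Regret bounds for every value of the free parameter `r`: one linear in `n`, one through the
information gained about the noise that generates the parameters. -/
theorem bayesRegret_linearModel_le {d L : ℕ} (hL : 1 ≤ L) {σ : ℝ} (hσ : 0 < σ) {s : ℕ → ℝ}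
    (hs : ∀ ℓ ∈ Finset.Icc 1 (L + 1), 0 < s ℓ) {K : ℕ} [NeZero K]
    {W : ℕ → Matrix (Fin d) (Fin d) ℝ} (ctx : (t : ℕ) → Kernel (History d K t) (Vec d))
    [∀ t, IsMarkovKernel (ctx t)] (hW : UnitMixing L W) (hctx : UnitContexts ctx) (n : ℕ)
    {γ : ℝ} (hγ : γ = ∑ j ∈ Finset.Icc 1 (L + 1), s j ^ 2) {r : ℝ} (hr : 0 < r) :
    Integrable (linearModel L W s σ).regret ((linearModel L W s σ).runLaw ctx n) ∧
    (linearModel L W s σ).bayesRegret ctx n ≤ n * (Real.log K / r) + r / 2 * (n * γ) ∧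
    (linearModel L W s σ).bayesRegret ctx n ≤ n * (Real.log K / r) + r / 2 *
      ((σ ^ 2 + γ) * ((d * (K + L) : ℕ) *
        Real.log (1 + n * γ / ((d * (K + L) : ℕ) * σ ^ 2)))) := by
  obtain ⟨ι, i1, i2, T, hcard, hprior, hT⟩ := exists_prior_eq_map K hL σ hs hW
  rw [← hγ] at hT
  set M := linearModel L W s σ with hMdef
  have hM : M.Regular := regular_linearModel hL W s hσ
  have hv : (M.noiseVar : ℝ) = σ ^ 2 := Real.coe_toNNReal _ (sq_nonneg σ)
  have hv0 : (0 : ℝ) < M.noiseVar := by rw [hv]; positivity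
  have hd := pos_of_unitMixing hL hW
  have hι : 0 < Fintype.card ι := by rw [hcard]; positivity
  have hγ0 : 0 ≤ γ := by rw [hγ]; positivity
  have hctx' : ∀ t h, ∀ᵐ x ∂(ctx t h), ‖x‖ = 1 := fun t h => by
    filter_upwards [hctx t h] with x hx
    exact (pow_eq_one_iff_of_nonneg (norm_nonneg x) two_ne_zero).1 hx
  have hfeat : ∀ x a, ‖x‖ = 1 → feature T x a ⬝ᵥ feature T x a ≤ γ := fun x a hx => by
    simpa [dotProduct, feature, sq] using hT x a hx
  have hvar0 : ∀ (t : ℕ) (h : History d K t) x a, 0 ≤ posteriorVar T M.noiseVar h x a :=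
    fun t h => posteriorVar_nonneg T hv0.le h
  have hvar : ∀ (t : ℕ) (h : History d K t) x a, ‖x‖ = 1 →
      posteriorVar T M.noiseVar h x a ≤ γ := fun t h x a hx =>
    (dotProduct_inv_precision_mulVec_le hv0.le _ _).trans (hfeat x a hx)
  have hq : ∀ (t : ℕ) (h : History d K t) x a, ∃ m : ℝ, HasSubgaussianMGF
      (fun θ : Params d K => ⟪x, θ a⟫ - m) (posteriorVar T M.noiseVar h x a).toNNReal
      (M.sampleLaw h) := fun t h x a => exists_hasSubgaussianMGF_sampleLaw hM hprior h x a
  have hqm : ∀ (t : ℕ) (h : History d K t) a,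
      Measurable fun x => posteriorVar T M.noiseVar h x a := fun t h a => by
    have hf : ∀ i, Measurable fun x => feature T x a i := fun i =>
      measurable_id.inner measurable_const
    unfold posteriorVar dotProduct Matrix.mulVec dotProduct
    exact Finset.measurable_fun_sum _ fun i _ => (hf i).mul
      (Finset.measurable_fun_sum _ fun j _ => (hf j).const_mul _)
  have h1 := hM.integrable_regret_and_bayesRegret_le ctx hctx' hvar0 hq hqm
    (G := fun t _ => t * γ) (fun t => measurable_const) (fun t _ => by positivity)
    (fun t h x a y hx => by have := hvar t h x a hx; push_cast; linarith) hr n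
    (B := n * γ) (by positivity) (fun _ _ => le_rfl)
  have hN : 0 ≤ Real.log (1 + n * γ / ((d * (K + L) : ℕ) * σ ^ 2)) :=
    Real.log_nonneg (by simp only [le_add_iff_nonneg_right]; positivity)
  have h2 := hM.integrable_regret_and_bayesRegret_le ctx hctx' hvar0 hq hqm
    (G := fun t h => (M.noiseVar + γ) *
      Real.log (precision (M.noiseVar : ℝ) fun i => feature T (h i).1 (h i).2.1).det)
    (fun t => (measurable_log_det_precision T _).const_mul _)
    (fun t h => mul_nonneg (by positivity) (log_det_precision_nonneg hv0.le _))
    (fun t h x a y hx => by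
      have e : (fun i => feature T ((Fin.snoc h (x, a, y) : History d K (t + 1)) i).1
          ((Fin.snoc h (x, a, y) : History d K (t + 1)) i).2.1)
          = (Fin.snoc (fun i => feature T (h i).1 (h i).2.1) (feature T x a) :
            Fin (t + 1) → ι → ℝ) := by
        funext i
        refine Fin.lastCases ?_ (fun j => ?_) i <;> simp
      rw [e, log_det_precision_snoc hv0.le, mul_add]
      exact add_le_add_right (le_mul_log_one_add (hvar0 t h x a) (hvar t h x a hx) hv0) _)
    hr n (B := (σ ^ 2 + γ) * ((d * (K + L) : ℕ) *
        Real.log (1 + n * γ / ((d * (K + L) : ℕ) * σ ^ 2)))) (by positivity) (fun h hh => by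
      rw [← hv, ← hcard]
      exact mul_le_mul_of_nonneg_left (log_det_precision_le hv0.le _
        (fun i => hfeat _ _ (hh i)) hγ0 hι) (by positivity))
  exact ⟨h1.1, h1.2, h2.2⟩

/-! ### Comparing the bounds -/

/-- Optimising a bound `a / r + r / 2 * B` over `r`. -/
theorem le_sqrt_of_forall_le {X a B : ℝ} (ha : 0 ≤ a) (hB : 0 ≤ B)
    (h : ∀ r : ℝ, 0 < r → X ≤ a / r + r / 2 * B) : X ≤ √(2 * a * B) := by
  rcases le_or_gt X 0 with hX | hX
  · exact hX.trans (Real.sqrt_nonneg _)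
  rcases hB.eq_or_lt with rfl | hB
  · have hr : 0 < (a + 1) / X := by positivity
    have h1 := h _ hr
    rw [mul_zero, add_zero, le_div_iff₀ hr, mul_div_cancel₀ _ hX.ne'] at h1
    linarith
  · have h1 := h (X / B) (by positivity)
    refine Real.le_sqrt_of_sq_le ?_
    have h2 : a / (X / B) + X / B / 2 * B = (2 * a * B + X ^ 2) / (2 * X) := by
      field_simp
    rw [h2, le_div_iff₀ (by positivity)] at h1
    nlinarith

theorem log_one_add_mul_le {κ x : ℝ} (hκ : 0 ≤ κ) (hx : 0 ≤ x) :
    Real.log (1 + κ * x) ≤ (1 + κ) * Real.log (1 + x) := by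
  rw [← Real.log_rpow (by linarith)]
  refine Real.log_le_log (by positivity) ?_
  have := one_add_mul_self_le_rpow_one_add (s := x) (by linarith) (p := 1 + κ) (by linarith)
  linarith

/-- The constant comparing the information gain with `d K log (1 + n σ_1² / d)`. -/
noncomputable def gainConst (L : ℕ) (σ γ s₁ : ℝ) : ℝ :=
  (σ ^ 2 + γ) * (L + 1) * (1 + γ / (σ ^ 2 * s₁ ^ 2))

theorem gain_le {d K L : ℕ} (hd : 0 < d) (hK : 0 < K) {σ γ s₁ : ℝ} (hσ : 0 < σ) (hγ : 0 ≤ γ)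
    (hs : 0 < s₁) (n : ℕ) :
    (σ ^ 2 + γ) * ((d * (K + L) : ℕ) * Real.log (1 + n * γ / ((d * (K + L) : ℕ) * σ ^ 2)))
      ≤ gainConst L σ γ s₁ * (d * K * Real.log (1 + n * s₁ ^ 2 / d)) := by
  have hd' : (1 : ℝ) ≤ d := by exact_mod_cast hd
  have hK' : (1 : ℝ) ≤ K := by exact_mod_cast hK
  have hL' : (0 : ℝ) ≤ L := by positivity
  have hN : ((d * (K + L) : ℕ) : ℝ) = d * (K + L) := by push_cast; ring
  have h1 : (d : ℝ) * (K + L) ≤ d * K * (L + 1) := by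
    nlinarith [mul_nonneg (mul_nonneg (by linarith : (0 : ℝ) ≤ d) hL') (sub_nonneg.2 hK')]
  have h2 : (d : ℝ) ≤ d * (K + L) := by nlinarith
  set x : ℝ := n * s₁ ^ 2 / d with hx
  have hx0 : 0 ≤ x := by positivity
  set κ : ℝ := γ / (σ ^ 2 * s₁ ^ 2) with hκ
  have hκ0 : 0 ≤ κ := by positivity
  have h3 : n * γ / (d * (K + L) * σ ^ 2) ≤ κ * x := by
    have e : κ * x = n * γ / (d * σ ^ 2) := by
      rw [hκ, hx]; field_simp
    rw [e]
    gcongr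
  have h4 : Real.log (1 + n * γ / (d * (K + L) * σ ^ 2)) ≤ (1 + κ) * Real.log (1 + x) :=
    (Real.log_le_log (by positivity) (by linarith)).trans (log_one_add_mul_le hκ0 hx0)
  have h5 : 0 ≤ Real.log (1 + x) := Real.log_nonneg (by linarith)
  have h6 : 0 ≤ Real.log (1 + n * γ / (d * (K + L) * σ ^ 2)) := Real.log_nonneg (by
    simp only [le_add_iff_nonneg_right]; positivity)
  rw [hN, gainConst, ← hκ]
  calc (σ ^ 2 + γ) * (d * (K + L) * Real.log (1 + n * γ / (d * (K + L) * σ ^ 2)))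
      ≤ (σ ^ 2 + γ) * (d * K * (L + 1) * ((1 + κ) * Real.log (1 + x))) := by gcongr
    _ = _ := by ring

theorem actTerm_nonneg (d K n : ℕ) {s : ℕ → ℝ} (hs : 0 < s 1) : 0 ≤ actTerm d K n s := by
  have h1 : 0 ≤ Real.log (1 + s 1 ^ 2) := Real.log_nonneg (by nlinarith [sq_nonneg (s 1)])
  have h2 : 0 ≤ Real.log (1 + n * s 1 ^ 2 / d) := Real.log_nonneg (by
    have : 0 ≤ n * s 1 ^ 2 / d := by positivity
    linarith)
  unfold actTerm
  positivity

theorem sigmaMaxSq_nonneg (L : ℕ) (s : ℕ → ℝ) (σ : ℝ) : 0 ≤ sigmaMaxSq L s σ := by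
  refine le_trans ?_ (Finset.le_sup' (fun ℓ => 1 + s ℓ ^ 2 / σ ^ 2)
    (Finset.mem_Icc.2 ⟨le_rfl, Nat.le_add_left 1 L⟩))
  positivity

theorem latTerm_nonneg (d L : ℕ) (s : ℕ → ℝ) (σ : ℝ) (ℓ : ℕ) : 0 ≤ latTerm d L s σ ℓ := by
  have h1 : 0 ≤ Real.log (1 + s (ℓ + 1) ^ 2) :=
    Real.log_nonneg (by nlinarith [sq_nonneg (s (ℓ + 1))])
  have h2 : 0 ≤ Real.log (1 + s (ℓ + 1) ^ 2 / s ℓ ^ 2) := Real.log_nonneg (by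
    have : 0 ≤ s (ℓ + 1) ^ 2 / s ℓ ^ 2 := by positivity
    linarith)
  have h3 := sigmaMaxSq_nonneg L s σ
  unfold latTerm
  positivity

/-- The two regret bounds after optimisation over the free parameter. -/
theorem bayesRegret_linearModel_le_sqrt {d L : ℕ} (hL : 1 ≤ L) {σ : ℝ} (hσ : 0 < σ) {s : ℕ → ℝ}
    (hs : ∀ ℓ ∈ Finset.Icc 1 (L + 1), 0 < s ℓ) {K : ℕ} [NeZero K]
    {W : ℕ → Matrix (Fin d) (Fin d) ℝ} (ctx : (t : ℕ) → Kernel (History d K t) (Vec d))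
    [∀ t, IsMarkovKernel (ctx t)] (hW : UnitMixing L W) (hctx : UnitContexts ctx) (n : ℕ)
    {γ : ℝ} (hγ : γ = ∑ j ∈ Finset.Icc 1 (L + 1), s j ^ 2) :
    Integrable (linearModel L W s σ).regret ((linearModel L W s σ).runLaw ctx n) ∧
    (linearModel L W s σ).bayesRegret ctx n
      ≤ √(2 * (n * (Real.log K + 1)) * (n * γ)) ∧
    (linearModel L W s σ).bayesRegret ctx n ≤ √(2 * (n * (Real.log K + 1)) *
      (gainConst L σ γ (s 1) * (d * K * Real.log (1 + n * s 1 ^ 2 / d)))) := by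
  have hK : 0 < K := Nat.pos_of_ne_zero (NeZero.ne K)
  have hlog : 0 ≤ Real.log K := Real.log_natCast_nonneg K
  have hγ0 : 0 ≤ γ := by rw [hγ]; positivity
  have hs1 : 0 < s 1 := hs 1 (by simp)
  have hd := pos_of_unitMixing hL hW
  have hmain := fun r (hr : 0 < r) =>
    bayesRegret_linearModel_le hL hσ hs ctx hW hctx n hγ (r := r) hr
  have hQ : ∀ r : ℝ, 0 < r →
      n * (Real.log K / r) ≤ n * (Real.log K + 1) / r := fun r hr => by
    rw [mul_div_assoc]
    gcongr
    linarith
  have hgain := gain_le (L := L) hd hK hσ hγ0 hs1 n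
  have hlog2 : 0 ≤ Real.log (1 + n * s 1 ^ 2 / d) := Real.log_nonneg (by
    simp only [le_add_iff_nonneg_right]; positivity)
  refine ⟨(hmain 1 one_pos).1, le_sqrt_of_forall_le (by positivity) (by positivity) fun r hr => ?_,
    le_sqrt_of_forall_le (by positivity) ?_ fun r hr => ?_⟩
  · exact (hmain r hr).2.1.trans (add_le_add_left (hQ r hr) _)
  · unfold gainConst; positivity
  · exact (hmain r hr).2.2.trans (add_le_add (hQ r hr)
      (mul_le_mul_of_nonneg_left hgain (by positivity)))

/-- A bound linear in `n` and a bound `√n` up to constants combine to a bound with confidence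
level `δ`: the first is used for large `δ`, the second for small `δ`. -/
theorem le_sqrt_log_add {X n R A Q b C δ : ℝ} (hn : 0 ≤ n) (hA : 0 ≤ A) (hAR : A ≤ R)
    (hδ : δ ∈ Set.Ioo (0 : ℝ) 1) (h1 : X ≤ b * n) (h2 : X ≤ √(2 * (n * Q) * (C * A)))
    (hb : 0 ≤ b) :
    X ≤ √(2 * n * R * Real.log (1 / δ)) + b * Real.exp (C * Q) * n * δ := by
  have hl : 0 ≤ Real.log (1 / δ) := Real.log_nonneg (by
    rw [le_div_iff₀ hδ.1]; linarith [hδ.2])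
  have hδ0 := hδ.1
  rcases le_or_gt (C * Q) (Real.log (1 / δ)) with h | h
  · have h3 : 2 * (n * Q) * (C * A) ≤ 2 * n * R * Real.log (1 / δ) := by
      calc 2 * (n * Q) * (C * A) = 2 * n * A * (C * Q) := by ring
        _ ≤ 2 * n * A * Real.log (1 / δ) := by gcongr
        _ ≤ _ := by gcongr
    have h4 : 0 ≤ b * Real.exp (C * Q) * n * δ := by positivity
    linarith [h2.trans (Real.sqrt_le_sqrt h3)]
  · have h3 : 1 ≤ Real.exp (C * Q) * δ := by
      rw [Real.log_lt_iff_lt_exp (by positivity), div_lt_iff₀ hδ0] at h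
      exact h.le
    have h4 : b * n * 1 ≤ b * n * (Real.exp (C * Q) * δ) := by gcongr
    have h5 : b * Real.exp (C * Q) * n * δ = b * n * (Real.exp (C * Q) * δ) := by ring
    linarith [Real.sqrt_nonneg (2 * n * R * Real.log (1 / δ))]

/-- Both bounds are of order `√n` up to logarithmic factors, uniformly in `K`: for `K ≤ n` the
factor `log K` is at most `log n`, and for `K > n` the bound linear in `n` suffices. -/
theorem le_mul_log_mul_sqrt {X γ g s₁ S : ℝ} {d K n : ℕ} (hn : 2 ≤ n) (hd : 0 < d) (hK : 0 < K)
    (hγ : 0 ≤ γ) (hg : 0 ≤ g) (hs : 0 < s₁) (hS : d * K * s₁ ^ 2 ≤ S)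
    (h1 : X ≤ √(2 * (n * (Real.log K + 1)) * (n * γ)))
    (h2 : X ≤ √(2 * (n * (Real.log K + 1)) * (g * (d * K * Real.log (1 + n * s₁ ^ 2 / d))))) :
    X ≤ √((6 * g * (1 + 2 * Real.log (1 + s₁ ^ 2)) + 20 * γ) / s₁ ^ 2)
      * Real.log n ^ 1 * √(n * S) := by
  have hn' : (2 : ℝ) ≤ n := by exact_mod_cast hn
  have hd' : (1 : ℝ) ≤ d := by exact_mod_cast hd
  have hK' : (1 : ℝ) ≤ K := by exact_mod_cast hK
  set l := Real.log n with hl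
  have hl1 : 1 ≤ 2 * l := by
    have := Real.log_le_log (by norm_num) hn'
    have := Real.log_two_gt_d9
    linarith
  have hl0 : 0 < l := by linarith
  have hlogK : 0 ≤ Real.log K := Real.log_nonneg hK'
  set e := Real.log (1 + s₁ ^ 2) with he
  have he0 : 0 ≤ e := Real.log_nonneg (by nlinarith [sq_nonneg s₁])
  suffices h : X ≤ √((6 * g * (1 + 2 * e) + 20 * γ) * l ^ 2 * (n * (d * K))) by
    refine h.trans ?_
    rw [pow_one, ← Real.sqrt_sq hl0.le, ← Real.sqrt_mul (by positivity),
      ← Real.sqrt_mul (by positivity), Real.sqrt_sq hl0.le]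
    refine Real.sqrt_le_sqrt ?_
    calc (6 * g * (1 + 2 * e) + 20 * γ) * l ^ 2 * (n * (d * K))
        = (6 * g * (1 + 2 * e) + 20 * γ) / s₁ ^ 2 * l ^ 2 * (n * (d * K * s₁ ^ 2)) := by
          field_simp
      _ ≤ _ := by gcongr
  rcases le_or_gt K n with hKn | hKn
  · refine h2.trans (Real.sqrt_le_sqrt ?_)
    have h3 : Real.log K + 1 ≤ 3 * l := by
      have : Real.log K ≤ l := Real.log_le_log (by linarith) (by exact_mod_cast hKn)
      linarith
    have h4 : Real.log (1 + n * s₁ ^ 2 / d) ≤ (1 + 2 * e) * l := by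
      have h5 : 1 + n * s₁ ^ 2 / d ≤ n * (1 + s₁ ^ 2) := by
        have : n * s₁ ^ 2 / d ≤ n * s₁ ^ 2 := div_le_self (by positivity) hd'
        nlinarith
      have h6 := Real.log_le_log (by positivity) h5
      rw [Real.log_mul (by positivity) (by positivity)] at h6
      nlinarith
    have h7 : 0 ≤ Real.log (1 + n * s₁ ^ 2 / d) := Real.log_nonneg (by
      simp only [le_add_iff_nonneg_right]; positivity)
    calc 2 * (n * (Real.log K + 1)) * (g * (d * K * Real.log (1 + n * s₁ ^ 2 / d)))
        ≤ 2 * (n * (3 * l)) * (g * (d * K * ((1 + 2 * e) * l))) := by gcongr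
      _ = (6 * g * (1 + 2 * e)) * l ^ 2 * (n * (d * K)) := by ring
      _ ≤ _ := by gcongr; linarith
  · refine h1.trans (Real.sqrt_le_sqrt ?_)
    have hKn' : (n : ℝ) ≤ K := by exact_mod_cast hKn.le
    have h3 : n * (Real.log K + 1) ≤ 10 * K * l ^ 2 := by
      have h4 : Real.log K = l + Real.log (K / n) := by
        rw [Real.log_div (by positivity) (by positivity)]; ring
      have h5 := Real.log_le_sub_one_of_pos (show (0 : ℝ) < K / n by positivity)
      have h6 : n * Real.log (K / n) ≤ K := by
        have := mul_le_mul_of_nonneg_left h5 (by linarith : (0 : ℝ) ≤ n)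
        rw [mul_sub, mul_div_cancel₀ _ (by positivity)] at this
        linarith
      have h7 : n * l ≤ K * l := by gcongr
      have h8 : n * (Real.log K + 1) ≤ K * l + 2 * K := by rw [h4]; linarith
      have h9 : (K : ℝ) * 1 ≤ K * (2 * l) := by gcongr
      have h10 : (5 * K * l) * 1 ≤ (5 * K * l) * (2 * l) := by gcongr
      nlinarith
    have h11 : (n : ℝ) * γ * (K * 1) ≤ n * γ * (K * d) := by gcongr
    calc 2 * (n * (Real.log K + 1)) * (n * γ)
        ≤ 2 * (10 * K * l ^ 2) * (n * γ) := by gcongr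
      _ = 20 * l ^ 2 * (n * γ * (K * 1)) := by ring
      _ ≤ 20 * l ^ 2 * (n * γ * (K * d)) := by gcongr
      _ = (20 * γ) * l ^ 2 * (n * (d * K)) := by ring
      _ ≤ _ := by
        have : 0 ≤ 6 * g * (1 + 2 * e) := by positivity
        gcongr
        linarith

end DiffusionTS

theorem mainTheorem1 (L : ℕ) (hL : 1 ≤ L) (σ : ℝ) (hσ : 0 < σ) (s : ℕ → ℝ)
    (hs : ∀ ℓ ∈ Finset.Icc 1 (L + 1), 0 < s ℓ) :
    (∀ (K : ℕ) [NeZero K], ∃ c : ℝ, 0 < c ∧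
      ∀ (d : ℕ) (W : ℕ → Matrix (Fin d) (Fin d) ℝ)
        (ctx : (t : ℕ) → Kernel (DiffusionTS.History d K t) (DiffusionTS.Vec d))
        [∀ t, IsMarkovKernel (ctx t)],
        DiffusionTS.UnitMixing L W → DiffusionTS.UnitContexts ctx →
        ∀ n : ℕ,
          Integrable (DiffusionTS.linearModel L W s σ).regret
            ((DiffusionTS.linearModel L W s σ).runLaw ctx n) ∧
          ∀ δ ∈ Set.Ioo (0 : ℝ) 1,
            (DiffusionTS.linearModel L W s σ).bayesRegret ctx n ≤
              Real.sqrt (2 * n * (DiffusionTS.actTerm d K n s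
                + ∑ ℓ ∈ Finset.Icc 1 L, DiffusionTS.latTerm d L s σ ℓ) * Real.log (1 / δ))
              + c * n * δ) ∧
    (∃ C : ℝ, 0 < C ∧ ∃ k : ℕ,
      ∀ (K : ℕ) [NeZero K] (d : ℕ) (W : ℕ → Matrix (Fin d) (Fin d) ℝ)
        (ctx : (t : ℕ) → Kernel (DiffusionTS.History d K t) (DiffusionTS.Vec d))
        [∀ t, IsMarkovKernel (ctx t)],
        DiffusionTS.UnitMixing L W → DiffusionTS.UnitContexts ctx →
        ∀ n : ℕ, 2 ≤ n →
          (DiffusionTS.linearModel L W s σ).bayesRegret ctx n ≤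
            C * Real.log n ^ k * Real.sqrt (n * (d * K * s 1 ^ 2
              + d * ∑ ℓ ∈ Finset.Icc 1 L,
                  s (ℓ + 1) ^ 2 * DiffusionTS.sigmaMaxSq L s σ ^ ℓ))) := by
  have hs1 : 0 < s 1 := hs 1 (by simp)
  set γ := ∑ j ∈ Finset.Icc 1 (L + 1), s j ^ 2 with hγ
  have hγ0 : 0 < γ := Finset.sum_pos (fun j hj => pow_pos (hs j hj) 2) ⟨1, by simp⟩
  set g := DiffusionTS.gainConst L σ γ (s 1) with hg
  have hg0 : 0 < g := by
    rw [hg, DiffusionTS.gainConst]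
    positivity
  have hlog : 0 < Real.log (1 + s 1 ^ 2) := Real.log_pos (by nlinarith [pow_pos hs1 2])
  constructor
  · intro K _
    have hQ : 0 < Real.log K + 1 := by linarith [Real.log_natCast_nonneg K]
    -- `actTerm` is `σ_1² / log (1 + σ_1²)` times the quantity in the information bound
    set C := g / (s 1 ^ 2 / Real.log (1 + s 1 ^ 2)) with hC
    refine ⟨√(2 * (Real.log K + 1) * γ) * Real.exp (C * (Real.log K + 1)), by positivity, ?_⟩
    intro d W ctx _ hW hctx n
    obtain ⟨hint, h1, h2⟩ :=
      DiffusionTS.bayesRegret_linearModel_le_sqrt hL hσ hs ctx hW hctx n hγ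
    refine ⟨hint, fun δ hδ => ?_⟩
    refine DiffusionTS.le_sqrt_log_add (C := C) (Q := Real.log K + 1) n.cast_nonneg
      (DiffusionTS.actTerm_nonneg d K n hs1)
      (le_add_of_nonneg_right (Finset.sum_nonneg fun ℓ _ => DiffusionTS.latTerm_nonneg d L s σ ℓ))
      hδ ?_ ?_ (Real.sqrt_nonneg _)
    · refine h1.trans (le_of_eq ?_)
      rw [show 2 * (n * (Real.log K + 1)) * (n * γ) = (2 * (Real.log K + 1) * γ) * (n : ℝ) ^ 2 by
        ring, Real.sqrt_mul (by positivity), Real.sqrt_sq n.cast_nonneg]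
    · refine h2.trans (le_of_eq ?_)
      congr 2
      rw [hC, DiffusionTS.actTerm, ← hg]
      field_simp
  · refine ⟨√((6 * g * (1 + 2 * Real.log (1 + s 1 ^ 2)) + 20 * γ) / s 1 ^ 2), by positivity, 1, ?_⟩
    intro K _ d W ctx _ hW hctx n hn
    obtain ⟨-, h1, h2⟩ :=
      DiffusionTS.bayesRegret_linearModel_le_sqrt hL hσ hs ctx hW hctx n hγ
    have hσm := DiffusionTS.sigmaMaxSq_nonneg L s σ
    refine DiffusionTS.le_mul_log_mul_sqrt hn (DiffusionTS.pos_of_unitMixing hL hW)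
      (Nat.pos_of_ne_zero (NeZero.ne K)) hγ0.le hg0.le hs1 ?_ h1 h2
    exact le_add_of_nonneg_right (mul_nonneg d.cast_nonneg
      (Finset.sum_nonneg fun ℓ _ => mul_nonneg (sq_nonneg _) (pow_nonneg hσm ℓ)))
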